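/- \textbf{Conventions.} A composition is a finite (possibly empty) list $\mathbf s=(s_1,\dots,s_j)$ of positive integers, and for $N\ge 0$ \[ H_N(\mathbf s)=\sum_{N\ge n_1>\dots>n_j\ge 1}\frac1{n_1^{s_1}\cdots n_j^{s_j}}\in\mathbb Q , \] with $H_N(\varnothing)=1$. For rational numbers $x,y$ and a positive integer $m$, $x\equiv y \bmod m$ means that $m$ divides the numerator of $x-y$ in lowest terms. For positive integers $r,k$ and a prime $p$ put \[ C_{r,k,p}=\sum_{\substack{n_1,\dots,n_k\ge 1\\ n_1+\dots+n_k=p^r\\ p\,\nmid\, n_1\cdots n_k}}\frac1{n_1\cdots n_k}. \] Let $\mathbb Q_{p\to\infty}$ be the commutative $\mathbb Q$-algebra of the families $(a_p)\in\prod_p\mathbb Q_p$ with $v_p(a_p)$ bounded below, modulo the ideal of those with $v_p(a_p)\to\infty$ as $p\to\infty$. It carries the topology for which the subgroups $\mathrm{Fil}^n=\{(a_p): a_p\in p^n\mathbb Z_p \text{ for all but finitely many } p\}$, $n\in\mathbb Z$, are a neighbourhood basis of $0$. The MHS algebra is the set of the elements of $\mathbb Q_{p\to\infty}$ of the form $\sum_{i=1}^\infty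 \bigl(c_i p^{b_i}H_{p-1}(\mathbf s_i)\bigr)_p$, with $c_i\in\mathbb Q$, $b_i\in\mathbb Z$, $b_i\to\infty$, and compositions $\mathbf s_i$, all independent of $p$. \textbf{Theorem.} (1) There is an algorithm that, given positive integers $r$, $k$, $n$, outputs a finite list of compositions $\mathbf s_1,\dots,\mathbf s_m$, rational numbers $c_1,\dots,c_m$ and integers $b_1,\dots,b_m$ (which may depend on $r$, $k$, $n$, but do not depend on $p$) such that \[ C_{r,k,p}\equiv\sum_{i=1}^m c_i\,p^{b_i}H_{p-1}(\mathbf s_i) \bmod p^n \] for all sufficiently large primes $p$. (2) For all positive integers $r$ and $k$, the class of $(C_{r,k,p})_p$ in $\mathbb Q_{p\to\infty}$ lies in the MHS algebra. -/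

import Mathlib

open Filter Topology

namespace MHS

/-! ### Multiple harmonic sums and the curious sums -/

/-- A composition: a finite ordered list of positive integers (possibly empty). -/
def IsComposition (s : List ℕ) : Prop := ∀ x ∈ s, 0 < x

/-- The multiple harmonic sum
`H_N(s₁,…,s_k) = ∑_{N ≥ n₁ > … > n_k ≥ 1} 1 / (n₁^{s₁} ⋯ n_k^{s_k})`,
summed over the outermost variable `n₁` first; the empty composition gives `1`. -/
def harmonicSum : List ℕ → ℕ → ℚ
  | [], _ => 1
  | s :: t, N => ∑ m ∈ Finset.Icc 1 N, 1 / (m : ℚ) ^ s * harmonicSum t (m - 1)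

/-- `C_{r,k,p}`: the sum of `1 / (n₁ ⋯ n_k)` over all `k`-tuples of positive integers
with `n₁ + … + n_k = p ^ r` and `p ∤ n₁ ⋯ n_k`. -/
def curiousSum (r k p : ℕ) : ℚ :=
  ∑ f ∈ (Finset.Nat.antidiagonalTuple k (p ^ r)).filter
      (fun f => (∀ i, 1 ≤ f i) ∧ ¬ p ∣ ∏ i, f i),
    1 / ∏ i, (f i : ℚ)

/-- Congruence of rational numbers: `x ≡ y mod m` if `m` divides the numerator of `x - y`. -/
def RatModEq (m : ℕ) (x y : ℚ) : Prop := (m : ℤ) ∣ (x - y).num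

/-! ### Finite expansions as data for an algorithm

A term `c p^b H_{p-1}(s)` is presented by the finite data `(s, (u, d), b)`, where the rational
coefficient `c` is the fraction `u / d`. -/

/-- The data of a term: the composition `s`, the coefficient `u / d`, the exponent `b`. -/
abbrev TermData : Type := List ℕ × (ℤ × ℕ) × ℤ

/-- `s` is a composition, and the denominator of the coefficient is not zero. -/
def TermData.Valid (t : TermData) : Prop := IsComposition t.1 ∧ t.2.1.2 ≠ 0

/-- The value `c p^b H_{p-1}(s)` of a term at `p`. -/
def TermData.value (t : TermData) (p : ℕ) : ℚ :=
  ((t.2.1.1 : ℚ) / (t.2.1.2 : ℚ)) * (p : ℚ) ^ t.2.2 * harmonicSum t.1 (p - 1)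

/-! ### The ring `ℚ_{p → ∞}` -/

instance instFactPrime (p : Nat.Primes) : Fact (p : ℕ).Prime := ⟨p.2⟩

/-- `v_p(a_p)` is bounded below, uniformly in `p` (`v_p(x) ≥ N` is written `‖x‖ ≤ p ^ (-N)`). -/
def BoundedBelow (a : ∀ p : Nat.Primes, ℚ_[p]) : Prop :=
  ∃ N : ℤ, ∀ p : Nat.Primes, ‖a p‖ ≤ ((p : ℕ) : ℝ) ^ (-N)

theorem one_le_prime (p : Nat.Primes) : (1 : ℝ) ≤ ((p : ℕ) : ℝ) := by
  exact_mod_cast p.2.one_lt.le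

theorem prime_pos (p : Nat.Primes) : (0 : ℝ) < ((p : ℕ) : ℝ) :=
  lt_of_lt_of_le one_pos (one_le_prime p)

theorem norm_add_bound {p : Nat.Primes} {x y : ℚ_[p]} {M N K : ℤ}
    (hx : ‖x‖ ≤ ((p : ℕ) : ℝ) ^ (-M)) (hy : ‖y‖ ≤ ((p : ℕ) : ℝ) ^ (-N))
    (hM : K ≤ M) (hN : K ≤ N) : ‖x + y‖ ≤ ((p : ℕ) : ℝ) ^ (-K) := by
  refine (Padic.nonarchimedean x y).trans (max_le (hx.trans ?_) (hy.trans ?_))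
  · exact zpow_le_zpow_right₀ (one_le_prime p) (by omega)
  · exact zpow_le_zpow_right₀ (one_le_prime p) (by omega)

theorem norm_mul_bound {p : Nat.Primes} {x y : ℚ_[p]} {M N : ℤ}
    (hx : ‖x‖ ≤ ((p : ℕ) : ℝ) ^ (-M)) (hy : ‖y‖ ≤ ((p : ℕ) : ℝ) ^ (-N)) :
    ‖x * y‖ ≤ ((p : ℕ) : ℝ) ^ (-(M + N)) := by
  rw [norm_mul, neg_add, zpow_add₀ (prime_pos p).ne']
  exact mul_le_mul hx hy (norm_nonneg _) (zpow_nonneg (prime_pos p).le _)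

theorem norm_rat_le_den (p : Nat.Primes) (c : ℚ) :
    ‖(c : ℚ_[p])‖ ≤ ((p : ℕ) : ℝ) ^ (-(-(c.den : ℤ))) := by
  have hd : (c.den : ℚ_[p]) ≠ 0 := by exact_mod_cast c.den_nz
  have hlt : c.den < (p : ℕ) ^ c.den := Nat.lt_pow_self p.2.one_lt
  have h1 : ‖(c.den : ℚ_[p])‖ * ((p : ℕ) : ℝ) ^ c.den ≥ 1 := by
    have hv : padicValNat p c.den ≤ c.den := by
      have := padicValNat_le_nat_log (p := p) c.den
      exact this.trans (Nat.log_le_self _ _)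
    rw [Padic.norm_eq_zpow_neg_valuation hd, Padic.valuation_natCast, ← zpow_natCast,
      ← zpow_add₀ (prime_pos p).ne']
    exact one_le_zpow₀ (one_le_prime p) (by omega)
  have h2 : ‖(c : ℚ_[p])‖ * ‖(c.den : ℚ_[p])‖ ≤ 1 := by
    rw [← norm_mul]
    have : (c : ℚ_[p]) * (c.den : ℚ_[p]) = (c.num : ℚ_[p]) := by
      exact_mod_cast congrArg (fun q : ℚ => (q : ℚ_[p])) (Rat.mul_den_eq_num c)
    rw [this]
    exact Padic.norm_int_le_one _
  rw [neg_neg, zpow_natCast]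
  have hp : (0 : ℝ) ≤ ((p : ℕ) : ℝ) ^ c.den := pow_nonneg (prime_pos p).le _
  calc ‖(c : ℚ_[p])‖ = ‖(c : ℚ_[p])‖ * 1 := (mul_one _).symm
    _ ≤ ‖(c : ℚ_[p])‖ * (‖(c.den : ℚ_[p])‖ * ((p : ℕ) : ℝ) ^ c.den) :=
        mul_le_mul_of_nonneg_left h1 (norm_nonneg _)
    _ = (‖(c : ℚ_[p])‖ * ‖(c.den : ℚ_[p])‖) * ((p : ℕ) : ℝ) ^ c.den := by ring
    _ ≤ 1 * ((p : ℕ) : ℝ) ^ c.den := mul_le_mul_of_nonneg_right h2 hp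
    _ = _ := one_mul _

/-- The sequences `(a_p) ∈ ∏_p ℚ_p` with `v_p(a_p)` bounded below, a `ℚ`-algebra. -/
def boundedSeq : Subalgebra ℚ (∀ p : Nat.Primes, ℚ_[p]) where
  carrier := {a | BoundedBelow a}
  mul_mem' := by
    rintro a b ⟨M, hM⟩ ⟨N, hN⟩
    exact ⟨M + N, fun p => norm_mul_bound (hM p) (hN p)⟩
  add_mem' := by
    rintro a b ⟨M, hM⟩ ⟨N, hN⟩
    exact ⟨min M N, fun p => norm_add_bound (hM p) (hN p) (min_le_left _ _) (min_le_right _ _)⟩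
  algebraMap_mem' c := ⟨-(c.den : ℤ), fun p => by
    have h : (algebraMap ℚ (∀ p : Nat.Primes, ℚ_[p]) c) p = (c : ℚ_[p]) := by
      simp
    rw [h]
    exact norm_rat_le_den p c⟩

/-- The ideal of the sequences with `v_p(a_p) → ∞` as `p → ∞`. -/
def nullIdeal : Ideal boundedSeq where
  carrier := {a | ∀ N : ℤ, ∀ᶠ p in cofinite, ‖a.1 p‖ ≤ ((p : ℕ) : ℝ) ^ (-N)}
  zero_mem' := fun N => Eventually.of_forall fun p => by
    have h : (0 : boundedSeq).1 p = 0 := rfl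
    rw [h, norm_zero]
    exact zpow_nonneg (prime_pos p).le _
  add_mem' := by
    intro a b ha hb N
    filter_upwards [ha N, hb N] with p h1 h2
    exact norm_add_bound h1 h2 le_rfl le_rfl
  smul_mem' := by
    rintro ⟨c, M, hM⟩ a ha N
    filter_upwards [ha (N - M)] with p h
    have := norm_mul_bound (hM p) h
    rwa [add_sub_cancel] at this

/-- The `ℚ`-algebra `ℚ_{p → ∞}`. -/
def QInfty : Type := boundedSeq ⧸ nullIdeal

noncomputable instance : CommRing QInfty := inferInstanceAs (CommRing (boundedSeq ⧸ nullIdeal))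

noncomputable instance : Algebra ℚ QInfty := inferInstanceAs (Algebra ℚ (boundedSeq ⧸ nullIdeal))

/-- The class in `ℚ_{p → ∞}` of a sequence with valuations bounded below. -/
noncomputable def QInfty.mk : boundedSeq →+* QInfty := Ideal.Quotient.mk nullIdeal

/-- The sequences with `a_p ∈ p^n ℤ_p` for all but finitely many `p`. -/
def seqFil (n : ℤ) : AddSubgroup boundedSeq where
  carrier := {a | ∀ᶠ p in cofinite, ‖a.1 p‖ ≤ ((p : ℕ) : ℝ) ^ (-n)}
  zero_mem' := nullIdeal.zero_mem n
  add_mem' := by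
    intro a b ha hb
    change ∀ᶠ p : Nat.Primes in cofinite, ‖(a + b).1 p‖ ≤ ((p : ℕ) : ℝ) ^ (-n)
    filter_upwards [ha, hb] with p h1 h2
    exact norm_add_bound h1 h2 le_rfl le_rfl
  neg_mem' := by
    intro a ha
    change ∀ᶠ p : Nat.Primes in cofinite, ‖(-a).1 p‖ ≤ ((p : ℕ) : ℝ) ^ (-n)
    filter_upwards [ha] with p h
    have h' : (-a).1 p = -(a.1 p) := rfl
    rwa [h', norm_neg]

/-- The filtration `Fil^n` of `ℚ_{p → ∞}`. -/
noncomputable def QInfty.Fil (n : ℤ) : AddSubgroup QInfty :=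
  (seqFil n).map QInfty.mk.toAddMonoidHom

theorem QInfty.Fil_mono {m n : ℤ} (h : m ≤ n) : QInfty.Fil n ≤ QInfty.Fil m := by
  refine AddSubgroup.map_mono fun a ha => ?_
  have ha' : ∀ᶠ p : Nat.Primes in cofinite, ‖a.1 p‖ ≤ ((p : ℕ) : ℝ) ^ (-n) := ha
  change ∀ᶠ p : Nat.Primes in cofinite, ‖a.1 p‖ ≤ ((p : ℕ) : ℝ) ^ (-m)
  filter_upwards [ha'] with p hp
  refine hp.trans ?_
  exact zpow_le_zpow_right₀ (one_le_prime p) (by omega)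

theorem QInfty.mul_mem_Fil {m n : ℤ} {x y : QInfty} (hx : x ∈ QInfty.Fil m)
    (hy : y ∈ QInfty.Fil n) : x * y ∈ QInfty.Fil (m + n) := by
  obtain ⟨a, ha, rfl⟩ := hx
  obtain ⟨b, hb, rfl⟩ := hy
  refine ⟨a * b, ?_, map_mul QInfty.mk a b⟩
  change ∀ᶠ p : Nat.Primes in cofinite, ‖(a * b).1 p‖ ≤ ((p : ℕ) : ℝ) ^ (-(m + n))
  filter_upwards [ha, hb] with p h1 h2
  exact norm_mul_bound h1 h2

theorem QInfty.exists_mem_Fil (x : QInfty) : ∃ m, x ∈ QInfty.Fil m := by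
  obtain ⟨a, rfl⟩ := Ideal.Quotient.mk_surjective x
  obtain ⟨N, hN⟩ := a.2
  exact ⟨N, a, show ∀ᶠ p : Nat.Primes in cofinite, ‖a.1 p‖ ≤ ((p : ℕ) : ℝ) ^ (-N) from
    Eventually.of_forall hN, rfl⟩

theorem QInfty.ringSubgroupsBasis : RingSubgroupsBasis QInfty.Fil where
  inter i j := ⟨max i j, le_inf (QInfty.Fil_mono (le_max_left _ _))
    (QInfty.Fil_mono (le_max_right _ _))⟩
  mul i := ⟨max i 0, by
    rintro _ ⟨x, hx, y, hy, rfl⟩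
    exact QInfty.Fil_mono (by omega) (QInfty.mul_mem_Fil hx hy)⟩
  leftMul x i := by
    obtain ⟨m, hm⟩ := x.exists_mem_Fil
    exact ⟨i - m, fun y hy => QInfty.Fil_mono (by omega) (QInfty.mul_mem_Fil hm hy)⟩
  rightMul x i := by
    obtain ⟨m, hm⟩ := x.exists_mem_Fil
    exact ⟨i - m, fun y hy => QInfty.Fil_mono (by omega) (QInfty.mul_mem_Fil hy hm)⟩

/-- The topology of `ℚ_{p → ∞}`, for which the `Fil^n` are a neighbourhood basis of `0`. -/
noncomputable instance : TopologicalSpace QInfty := QInfty.ringSubgroupsBasis.topology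

/-! ### The MHS algebra -/

/-- A sequence of rational numbers, as an element of `∏_p ℚ_p`. -/
noncomputable def ratSeq (a : ℕ → ℚ) : ∀ p : Nat.Primes, ℚ_[p] := fun p => ((a p : ℚ) : ℚ_[p])

theorem norm_inv_natCast_of_not_dvd (p : Nat.Primes) {m : ℕ} (h : ¬ (p : ℕ) ∣ m) :
    ‖((1 / (m : ℚ) : ℚ) : ℚ_[p])‖ = 1 := by
  have h1 : ‖(m : ℚ_[p])‖ = 1 :=
    Padic.norm_natCast_eq_one_iff.2 ((Nat.Prime.coprime_iff_not_dvd p.2).2 h)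
  push_cast
  rw [norm_div, h1, norm_one, div_one]

theorem norm_harmonicSum_le (p : Nat.Primes) (s : List ℕ) :
    ∀ N : ℕ, N < p → ‖((harmonicSum s N : ℚ) : ℚ_[p])‖ ≤ 1 := by
  induction s with
  | nil => intro N _; simp [harmonicSum]
  | cons a t ih =>
    intro N hN
    rw [harmonicSum, Rat.cast_sum]
    refine IsUltrametricDist.norm_sum_le_of_forall_le_of_nonneg zero_le_one fun m hm => ?_
    rw [Finset.mem_Icc] at hm
    have hd : ¬ (p : ℕ) ∣ m ^ a := fun h =>
      absurd (Nat.le_of_dvd (by omega) (p.2.dvd_of_dvd_pow h)) (by omega)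
    have h1 := norm_inv_natCast_of_not_dvd p hd
    rw [Rat.cast_mul, norm_mul, ← Nat.cast_pow, h1, one_mul]
    exact ih _ (by omega)

theorem boundedBelow_term (c : ℚ) (b : ℤ) (s : List ℕ) :
    BoundedBelow (ratSeq fun p => c * (p : ℚ) ^ b * harmonicSum s (p - 1)) := by
  refine ⟨-(c.den : ℤ) + b + 0, fun p => ?_⟩
  have h1 : ‖((((p : ℕ) : ℚ) ^ b : ℚ) : ℚ_[p])‖ ≤ ((p : ℕ) : ℝ) ^ (-b) := by
    push_cast
    exact (Padic.norm_p_zpow b).le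
  have h2 : ‖((harmonicSum s (p - 1) : ℚ) : ℚ_[p])‖ ≤ ((p : ℕ) : ℝ) ^ (-(0 : ℤ)) := by
    rw [neg_zero, zpow_zero]
    exact norm_harmonicSum_le p s _ (Nat.sub_lt p.2.pos one_pos)
  have h3 := norm_mul_bound (norm_mul_bound (norm_rat_le_den p c) h1) h2
  rwa [← Rat.cast_mul, ← Rat.cast_mul] at h3

theorem boundedBelow_curiousSum (r k : ℕ) : BoundedBelow (ratSeq (curiousSum r k)) := by
  refine ⟨0, fun p => ?_⟩
  rw [neg_zero, zpow_zero]
  simp only [ratSeq, curiousSum]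
  rw [Rat.cast_sum]
  refine IsUltrametricDist.norm_sum_le_of_forall_le_of_nonneg zero_le_one fun f hf => ?_
  have h := norm_inv_natCast_of_not_dvd p (Finset.mem_filter.1 hf).2.2
  rw [← Nat.cast_prod]
  exact h.le

/-- The element `(c p^b H_{p-1}(s))_p` of `ℚ_{p → ∞}`. -/
noncomputable def QInfty.term (c : ℚ) (b : ℤ) (s : List ℕ) : QInfty :=
  QInfty.mk ⟨ratSeq fun p => c * (p : ℚ) ^ b * harmonicSum s (p - 1), boundedBelow_term c b s⟩

/-- The element `(C_{r,k,p})_p` of `ℚ_{p → ∞}`. -/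
noncomputable def QInfty.curious (r k : ℕ) : QInfty :=
  QInfty.mk ⟨ratSeq (curiousSum r k), boundedBelow_curiousSum r k⟩

/-- The MHS algebra: the elements of `ℚ_{p → ∞}` that are the sum of a series
`∑_i (c_i p^{b_i} H_{p-1}(s_i))_p` with rational `c_i`, integers `b_i → ∞` and compositions `s_i`
that do not depend on `p`. -/
def mhsAlgebra : Set QInfty :=
  {x | ∃ (c : ℕ → ℚ) (b : ℕ → ℤ) (s : ℕ → List ℕ), Tendsto b atTop atTop ∧
    (∀ i, IsComposition (s i)) ∧ HasSum (fun i => QInfty.term (c i) (b i) (s i)) x}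

end MHS

/-! Write each summation variable as n_i = p q_i + a_i with 0 < a_i < p. Then 1/n_i is the p-adic
geometric series ∑_j (-p q_i)^j / a_i^(j+1), so modulo p^n only finitely many terms matter. Since p
divides p^r, the residues satisfy ∑ a_i = p c with 0 ≤ c < k, and ∑ q_i = p^(r-1) - c. Rewriting
q_i^j in binomials (q_i choose f) turns the sum over the q_i into a single binomial coefficient,
which is a rational polynomial in p^(r-1). What remains are the sums of ∏ a_i^(-s_i) over 0 < a_i <
p with ∑ a_i = p c (`unitSum`).

To reduce these to multiple harmonic sums, replace one variable by p - x. The others then have total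
N = p q + x. The factor (p - x)^(-1) expands in powers of p. For the others, multiplication by their
total N acts on the generating series as the Euler operator X d/dX, which lowers one exponent by 1
(`mul_unitSum`), while 1/N = 1/(p q + x) expands in powers of p with coefficients that are powers of
1/x. Once an exponent reaches 0, that variable is free, and eliminating it sums over the p - 1
totals just below N: these are p q + b with b < x, or p (q - 1) + b with x < b < p. Thus x becomes a
link of a nested sum, and b is the new marked variable, placed into the nested sum by a stuffle
(`chain_mul_sum_Ioo`). Each step uses up exponents, so finally only a multiple harmonic sum H_{p-1}
is left (`expands_stateVal`).

Every step has the form `Expands`: an expansion in powers of p, valid modulo every p^n for almost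
all p, whose coefficients do not depend on p and are primitive recursive in the data. Such steps can
be composed (`Expands.trans`) and iterated (`Expands.iterate`). Truncating the final expansion at
p^n gives the algorithm; the whole expansion is a convergent series in the MHS algebra
(`main_of_expands`). -/

namespace MHS

/-! ### Divisibility of rational numbers by powers of `p` -/

/-- `x ∈ p ^ n ℤ_(p)`. -/
def Small (p n : ℕ) (x : ℚ) : Prop := ∃ y : ℚ, y.den.Coprime p ∧ x = (p : ℚ) ^ n * y

namespace Small

variable {p n m : ℕ} {x y : ℚ}

theorem zero_right (p n : ℕ) : Small p n 0 := ⟨0, by simp, by simp⟩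

theorem add (hx : Small p n x) (hy : Small p n y) : Small p n (x + y) := by
  obtain ⟨a, ha, rfl⟩ := hx
  obtain ⟨b, hb, rfl⟩ := hy
  exact ⟨a + b, Nat.Coprime.of_dvd_left (Rat.add_den_dvd a b) (ha.mul_left hb), by ring⟩

theorem neg (hx : Small p n x) : Small p n (-x) := by
  obtain ⟨a, ha, rfl⟩ := hx
  exact ⟨-a, by simpa using ha, by ring⟩

theorem mul (hx : Small p n x) (hy : Small p m y) : Small p (n + m) (x * y) := by
  obtain ⟨a, ha, rfl⟩ := hx
  obtain ⟨b, hb, rfl⟩ := hy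
  exact ⟨a * b, Nat.Coprime.of_dvd_left (Rat.mul_den_dvd a b) (ha.mul_left hb), by ring⟩

theorem mul_left (hx : Small p 0 x) (hy : Small p n y) : Small p n (x * y) := by
  simpa using hx.mul hy

theorem mul_right (hx : Small p n x) (hy : Small p 0 y) : Small p n (x * y) := by
  simpa using hx.mul hy

theorem intCast (p : ℕ) (z : ℤ) : Small p 0 (z : ℚ) := ⟨z, by simp, by simp⟩

theorem natCast (p : ℕ) (z : ℕ) : Small p 0 (z : ℚ) := ⟨z, by simp, by simp⟩

theorem one (p : ℕ) : Small p 0 (1 : ℚ) := ⟨1, by simp, by simp⟩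

theorem self_pow (p n : ℕ) : Small p n ((p : ℚ) ^ n) := ⟨1, by simp, by simp⟩

theorem mono (hx : Small p n x) (h : m ≤ n) : Small p m x := by
  obtain ⟨k, rfl⟩ := Nat.exists_eq_add_of_le h
  obtain ⟨a, ha, rfl⟩ := hx
  refine ⟨(p ^ k : ℕ) * a, Nat.Coprime.of_dvd_left (Rat.mul_den_dvd _ a) ?_, ?_⟩
  · simpa using ha
  · push_cast; ring

theorem pow (hx : Small p 0 x) (k : ℕ) : Small p 0 (x ^ k) := by
  induction k with
  | zero => simpa using one p
  | succ k ih => rw [pow_succ]; exact ih.mul_right hx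

theorem sum {ι : Type*} {s : Finset ι} {f : ι → ℚ} (h : ∀ i ∈ s, Small p n (f i)) :
    Small p n (∑ i ∈ s, f i) := by
  classical
  induction s using Finset.induction_on with
  | empty => simpa using zero_right p n
  | insert a s ha ih =>
    rw [Finset.sum_insert ha]
    exact (h a (by simp)).add (ih fun i hi => h i (by simp [hi]))

theorem listSum {l : List ℚ} (h : ∀ x ∈ l, Small p n x) : Small p n l.sum := by
  induction l with
  | nil => simpa using zero_right p n
  | cons a l ih =>
    rw [List.sum_cons]
    exact (h a (by simp)).add (ih fun i hi => h i (by simp [hi]))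

theorem inv_natCast {d : ℕ} (hp : p.Prime) (h : ¬ p ∣ d) : Small p 0 ((d : ℚ)⁻¹) := by
  refine ⟨(d : ℚ)⁻¹, ?_, by simp⟩
  rcases Nat.eq_zero_or_pos d with rfl | hd
  · simp
  rw [Rat.inv_natCast_den_of_pos hd]
  exact ((Nat.Prime.coprime_iff_not_dvd hp).2 h).symm

theorem ratModEq (h : Small p n (x - y)) : RatModEq (p ^ n) x y := by
  obtain ⟨z, hz, hxy⟩ := h
  have h1 : (x - y).num * (z.den : ℤ) = (p : ℤ) ^ n * z.num * ((x - y).den : ℤ) := by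
    have e1 := Rat.mul_den_eq_num (x - y)
    have e2 := Rat.mul_den_eq_num z
    have : ((x - y).num : ℚ) * z.den = (p : ℚ) ^ n * z.num * (x - y).den := by
      rw [← e1, ← e2, hxy]; ring
    exact_mod_cast this
  have h2 : ((p ^ n : ℕ) : ℤ) ∣ (x - y).num * (z.den : ℤ) := by
    rw [h1, Nat.cast_pow, mul_assoc]; exact dvd_mul_right _ _
  refine IsCoprime.dvd_of_dvd_mul_right ?_ h2
  exact Nat.isCoprime_iff_coprime.2 (hz.symm.pow_left n)

theorem norm_le {p : Nat.Primes} (h : Small p n x) :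
    ‖(x : ℚ_[p])‖ ≤ ((p : ℕ) : ℝ) ^ (-(n : ℤ)) := by
  obtain ⟨z, hz, rfl⟩ := h
  have h1 : ‖(z : ℚ_[p])‖ ≤ 1 :=
    Padic.norm_rat_le_one ((Nat.Prime.coprime_iff_not_dvd p.2).1 hz.symm)
  push_cast
  rw [norm_mul, norm_pow, Padic.norm_p, inv_pow, zpow_neg, zpow_natCast]
  exact mul_le_of_le_one_right (by positivity) h1

end Small

/-! ### Primitive recursive arithmetic on integers and fractions -/

theorem encode_int_ofNat (n : ℕ) : Encodable.encode (n : ℤ) = 2 * n := rfl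

theorem encode_int_negSucc (n : ℕ) : Encodable.encode (Int.negSucc n) = 2 * n + 1 := rfl

/-- The encoding of ℤ sends n to 2n and -(n+1) to 2n+1. Integer operations are reduced to natural
ones by writing an integer as a difference of its positive and negative parts, so this is the way
back to ℤ. -/
theorem primrec_int_subNat : Primrec₂ fun m n : ℕ => (m : ℤ) - n := by
  refine Primrec.encode_iff.1 ?_
  have h : Primrec fun x : ℕ × ℕ =>
      if x.2 ≤ x.1 then 2 * (x.1 - x.2) else 2 * (x.2 - x.1 - 1) + 1 := by
    refine Primrec.ite (Primrec.nat_le.comp Primrec.snd Primrec.fst) ?_ ?_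
    · exact Primrec.nat_double.comp (Primrec.nat_sub.comp Primrec.fst Primrec.snd)
    · exact Primrec.nat_double_succ.comp (Primrec.nat_sub.comp
        (Primrec.nat_sub.comp Primrec.snd Primrec.fst) (Primrec.const 1))
  refine h.of_eq ?_
  rintro ⟨m, n⟩
  dsimp only
  split_ifs with hmn
  · rw [← encode_int_ofNat, Nat.cast_sub hmn]
  · rw [← encode_int_negSucc]
    congr 1
    rw [Int.negSucc_eq]
    omega

theorem primrec_int_toNat : Primrec Int.toNat := by
  have h : Primrec fun z : ℤ => if (Encodable.encode z) % 2 = 0 then (Encodable.encode z) / 2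
      else 0 := by
    refine Primrec.ite (Primrec.eq.comp (Primrec.nat_mod.comp Primrec.encode (Primrec.const 2))
      (Primrec.const 0)) ?_ (Primrec.const 0)
    exact Primrec.nat_div.comp Primrec.encode (Primrec.const 2)
  refine h.of_eq fun z => ?_
  cases z with
  | ofNat n => simp [encode_int_ofNat]
  | negSucc n => simp [encode_int_negSucc, Nat.add_mod]

theorem primrec_int_neg_toNat : Primrec fun z : ℤ => (-z).toNat := by
  have h : Primrec fun z : ℤ => if (Encodable.encode z) % 2 = 0 then 0
      else (Encodable.encode z) / 2 + 1 := by
    refine Primrec.ite (Primrec.eq.comp (Primrec.nat_mod.comp Primrec.encode (Primrec.const 2))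
      (Primrec.const 0)) (Primrec.const 0) ?_
    exact Primrec.succ.comp (Primrec.nat_div.comp Primrec.encode (Primrec.const 2))
  refine h.of_eq fun z => ?_
  cases z with
  | ofNat n => simp [encode_int_ofNat]
  | negSucc n =>
    rw [encode_int_negSucc, Int.neg_negSucc]
    simp [Nat.add_mod]
    omega

theorem primrec_int_natCast : Primrec fun n : ℕ => (n : ℤ) :=
  (primrec_int_subNat.comp Primrec.id (Primrec.const 0)).of_eq fun n => by simp

theorem primrec_int_neg : Primrec fun z : ℤ => -z :=
  (primrec_int_subNat.comp primrec_int_neg_toNat primrec_int_toNat).of_eq fun z => by omega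

theorem primrec_int_mul : Primrec₂ fun a b : ℤ => a * b := by
  have h : Primrec fun x : ℤ × ℤ =>
      ((x.1.toNat * x.2.toNat + (-x.1).toNat * (-x.2).toNat : ℕ) : ℤ)
        - ((x.1.toNat * (-x.2).toNat + (-x.1).toNat * x.2.toNat : ℕ) : ℤ) := by
    have a := primrec_int_toNat.comp (Primrec.fst (α := ℤ) (β := ℤ))
    have b := primrec_int_toNat.comp (Primrec.snd (α := ℤ) (β := ℤ))
    have a' := primrec_int_neg_toNat.comp (Primrec.fst (α := ℤ) (β := ℤ))
    have b' := primrec_int_neg_toNat.comp (Primrec.snd (α := ℤ) (β := ℤ))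
    exact primrec_int_subNat.comp
      (Primrec.nat_add.comp (Primrec.nat_mul.comp a b) (Primrec.nat_mul.comp a' b'))
      (Primrec.nat_add.comp (Primrec.nat_mul.comp a b') (Primrec.nat_mul.comp a' b))
  refine h.of_eq ?_
  rintro ⟨x, y⟩
  dsimp only
  have hx : x = (x.toNat : ℤ) - ((-x).toNat : ℤ) := by omega
  have hy : y = (y.toNat : ℤ) - ((-y).toNat : ℤ) := by omega
  conv_rhs => rw [hx, hy]
  push_cast
  ring

theorem primrec_int_pow : Primrec₂ fun (a : ℤ) (b : ℕ) => a ^ b := by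
  have h : Primrec fun x : ℤ × ℕ => (fun y => x.1 * y)^[x.2] 1 :=
    Primrec.nat_iterate Primrec.snd (Primrec.const 1)
      (primrec_int_mul.comp (Primrec.fst.comp Primrec.fst) Primrec.snd).to₂
  refine h.of_eq ?_
  rintro ⟨a, b⟩
  simp [mul_left_iterate]

theorem primrec_factorial : Primrec Nat.factorial := by
  refine (Primrec.nat_rec₁ 1 (f := fun n y => (n + 1) * y)
    (Primrec.nat_mul.comp (Primrec.succ.comp Primrec.fst) Primrec.snd).to₂).of_eq fun n => ?_
  induction n with
  | zero => rfl
  | succ n ih => rw [Nat.factorial_succ, ← ih]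

/-- A fraction. -/
abbrev Coef : Type := ℤ × ℕ

/-- The value of a fraction. -/
def cval (c : Coef) : ℚ := (c.1 : ℚ) / (c.2 : ℚ)

/-- The product of two fractions. -/
def cmul (a b : Coef) : Coef := (a.1 * b.1, a.2 * b.2)

theorem cval_cmul (a b : Coef) : cval (cmul a b) = cval a * cval b := by
  simp [cval, cmul, mul_div_mul_comm]

theorem cval_int (z : ℤ) : cval (z, 1) = z := by simp [cval]

@[simp] theorem cval_one : cval (1, 1) = 1 := by simp [cval]

theorem primrec_cmul : Primrec₂ cmul :=
  Primrec.pair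
    (primrec_int_mul.comp (Primrec.fst.comp Primrec.fst) (Primrec.fst.comp Primrec.snd))
    (Primrec.nat_mul.comp (Primrec.snd.comp Primrec.fst) (Primrec.snd.comp Primrec.snd))

/-- A prime exceeding a nonzero denominator cannot divide it. This is where only almost all primes
are covered: coefficients must not destroy divisibility by p. -/
theorem eventually_small_cval (c : Coef) :
    ∀ᶠ p : ℕ in atTop, p.Prime → Small p 0 (cval c) := by
  filter_upwards [eventually_gt_atTop c.2] with p hp hpp
  rcases Nat.eq_zero_or_pos c.2 with h | h
  · rw [cval, h]; simpa using Small.zero_right p 0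
  · rw [cval, div_eq_mul_inv]
    exact (Small.intCast p _).mul_left
      (Small.inv_natCast hpp fun hd => absurd (Nat.le_of_dvd h hd) (by omega))

/-! ### Effective expansions in powers of `p` -/

/-- The linear combination of the values of `v` given by a list of coefficients and indices. -/
def lsum {β : Type*} (l : List (Coef × β)) (v : β → ℚ) : ℚ :=
  (l.map fun x => cval x.1 * v x.2).sum

section lsum

variable {β γ : Type*}

@[simp] theorem lsum_nil (v : β → ℚ) : lsum [] v = 0 := rfl

@[simp] theorem lsum_cons (x : Coef × β) (l : List (Coef × β)) (v : β → ℚ) :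
    lsum (x :: l) v = cval x.1 * v x.2 + lsum l v := by simp [lsum]

@[simp] theorem lsum_append (l l' : List (Coef × β)) (v : β → ℚ) :
    lsum (l ++ l') v = lsum l v + lsum l' v := by simp [lsum]

theorem lsum_flatMap {α : Type*} (l : List α) (f : α → List (Coef × β)) (v : β → ℚ) :
    lsum (l.flatMap f) v = (l.map fun a => lsum (f a) v).sum := by
  induction l with
  | nil => simp
  | cons a l ih => simp [ih]

theorem lsum_map_cmul (c : Coef) (l : List (Coef × β)) (v : β → ℚ) :
    lsum (l.map fun x => (cmul c x.1, x.2)) v = cval c * lsum l v := by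
  induction l with
  | nil => simp
  | cons a l ih => simp [ih, cval_cmul]; ring

theorem lsum_sub (l : List (Coef × β)) (v w : β → ℚ) :
    lsum l (fun b => v b - w b) = lsum l v - lsum l w := by
  induction l with
  | nil => simp
  | cons a l ih => simp [ih]; ring

theorem lsum_mul_left (a : ℚ) (l : List (Coef × β)) (v : β → ℚ) :
    lsum l (fun b => a * v b) = a * lsum l v := by
  induction l with
  | nil => simp
  | cons x l ih => simp [ih]; ring

theorem lsum_finset_sum {ι : Type*} (s : Finset ι) (l : List (Coef × β)) (v : ι → β → ℚ) :
    lsum l (fun b => ∑ i ∈ s, v i b) = ∑ i ∈ s, lsum l (v i) := by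
  induction l with
  | nil => simp
  | cons x l ih => simp [ih, Finset.mul_sum, Finset.sum_add_distrib]

theorem lsum_congr (l : List (Coef × β)) {v w : β → ℚ} (h : ∀ x ∈ l, v x.2 = w x.2) :
    lsum l v = lsum l w := by
  unfold lsum
  congr 1
  exact List.map_congr_left fun x hx => by rw [h x hx]

theorem sum_map_range (n : ℕ) (f : ℕ → ℚ) :
    ((List.range n).map f).sum = ∑ i ∈ Finset.range n, f i := by
  induction n with
  | zero => simp
  | succ n ih => simp [List.range_succ, Finset.sum_range_succ, ih]

theorem sum_flatMap {α : Type*} (l : List α) (f : α → List ℚ) :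
    (l.flatMap f).sum = (l.map fun a => (f a).sum).sum := by
  induction l with
  | nil => simp
  | cons a l ih => simp [ih]

theorem small_lsum {p n : ℕ} {l : List (Coef × β)} {v : β → ℚ}
    (hc : ∀ x ∈ l, Small p 0 (cval x.1)) (hv : ∀ x ∈ l, Small p n (v x.2)) :
    Small p n (lsum l v) := by
  refine Small.listSum fun y hy => ?_
  obtain ⟨x, hx, rfl⟩ := List.mem_map.1 hy
  exact (hc x hx).mul_left (hv x hx)

end lsum

theorem sum_range_sum_range_sub (n : ℕ) (f : ℕ → ℕ → ℚ) :
    ∑ l ∈ Finset.range n, ∑ j ∈ Finset.range (l + 1), f j (l - j) =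
      ∑ j ∈ Finset.range n, ∑ m ∈ Finset.range (n - j), f j m := by
  rw [Finset.sum_sigma', Finset.sum_sigma']
  refine Finset.sum_nbij' (fun x => ⟨x.2, x.1 - x.2⟩) (fun x => ⟨x.1 + x.2, x.1⟩) ?_ ?_ ?_ ?_ ?_
  · rintro ⟨a, b⟩ h; simp only [Finset.mem_sigma, Finset.mem_range] at h ⊢; omega
  · rintro ⟨a, b⟩ h; simp only [Finset.mem_sigma, Finset.mem_range] at h ⊢; omega
  · rintro ⟨a, b⟩ h
    simp only [Finset.mem_sigma, Finset.mem_range] at h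
    simp only [Sigma.mk.injEq, heq_eq_eq, and_true]; omega
  · rintro ⟨a, b⟩ h
    simp
  · rintro ⟨a, b⟩ h; rfl

/-- Substitution of one expansion into another, collected as a Cauchy product. A term already
carrying p^j needs its value only modulo p^(n-j). -/
theorem small_expansion_comp {β : Type*} {p n : ℕ} (A : ℕ → List (Coef × β)) (w : β → ℚ)
    (Θ : β → ℕ → ℚ) (hc : ∀ j < n, ∀ x ∈ A j, Small p 0 (cval x.1))
    (hΘ : ∀ j < n, ∀ x ∈ A j,
      Small p (n - j) (w x.2 - ∑ m ∈ Finset.range (n - j), (p : ℚ) ^ m * Θ x.2 m)) :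
    Small p n (∑ j ∈ Finset.range n, (p : ℚ) ^ j * lsum (A j) w -
      ∑ l ∈ Finset.range n, (p : ℚ) ^ l *
        ∑ j ∈ Finset.range (l + 1), lsum (A j) (fun b => Θ b (l - j))) := by
  have h1 : ∑ l ∈ Finset.range n, (p : ℚ) ^ l *
        ∑ j ∈ Finset.range (l + 1), lsum (A j) (fun b => Θ b (l - j)) =
      ∑ j ∈ Finset.range n, (p : ℚ) ^ j *
        lsum (A j) (fun b => ∑ m ∈ Finset.range (n - j), (p : ℚ) ^ m * Θ b m) := by
    have h2 := sum_range_sum_range_sub n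
      fun j m => (p : ℚ) ^ (j + m) * lsum (A j) (fun b => Θ b m)
    refine Eq.trans (Finset.sum_congr rfl fun l _ => ?_)
      (h2.trans (Finset.sum_congr rfl fun j _ => ?_))
    · rw [Finset.mul_sum]
      refine Finset.sum_congr rfl fun j hj => ?_
      rw [Nat.add_sub_cancel' (by simp at hj; omega)]
    · rw [lsum_finset_sum, Finset.mul_sum]
      refine Finset.sum_congr rfl fun m _ => ?_
      rw [lsum_mul_left, pow_add, mul_assoc]
  rw [h1, ← Finset.sum_sub_distrib]
  refine Small.sum fun j hj => ?_
  rw [← mul_sub, ← lsum_sub]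
  have hj' := Finset.mem_range.1 hj
  have := (Small.self_pow p j).mul (small_lsum (v := fun b =>
    w b - ∑ m ∈ Finset.range (n - j), (p : ℚ) ^ m * Θ b m) (hc j hj') (hΘ j hj'))
  rwa [Nat.add_sub_cancel' hj'.le] at this

theorem eventually_list {β : Type*} {l : List β} {P : β → ℕ → Prop}
    (h : ∀ x ∈ l, ∀ᶠ p : ℕ in atTop, P x p) : ∀ᶠ p : ℕ in atTop, ∀ x ∈ l, P x p := by
  induction l with
  | nil => simp
  | cons a l ih =>
    filter_upwards [h a (by simp), ih fun x hx => h x (by simp [hx])] with p h1 h2 x hx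
    rcases List.mem_cons.1 hx with rfl | hx
    · exact h1
    · exact h2 x hx

theorem eventually_lt_list {β : Type*} {n : ℕ} {A : ℕ → List β} {P : ℕ → β → ℕ → Prop}
    (h : ∀ j < n, ∀ x ∈ A j, ∀ᶠ p : ℕ in atTop, P j x p) :
    ∀ᶠ p : ℕ in atTop, ∀ j < n, ∀ x ∈ A j, P j x p := by
  have := (Filter.eventually_all_finite (Set.finite_lt_nat n) (l := atTop)
    (p := fun j p => ∀ x ∈ A j, P j x p)).2 fun j hj => eventually_list (h j hj)
  exact this

/-- `v a ≡ ∑_{j < n} p ^ j ∑ c w b` modulo `p ^ n` for almost all `p`, for every `n`, the inner sum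
being over the list `T a j` of pairs `(c, b)`. -/
def IsExpansion {α β : Type*} (T : α → ℕ → List (Coef × β)) (v : α → ℕ → ℚ) (w : β → ℕ → ℚ) :
    Prop :=
  ∀ a n, 0 < n → ∀ᶠ p : ℕ in atTop, p.Prime →
    Small p n (v a p - ∑ j ∈ Finset.range n, (p : ℚ) ^ j * lsum (T a j) (w · p))

/-- The `v a` have effective expansions in powers of `p` with coefficients in the span of the
`w b`. -/
def Expands {α β : Type*} [Primcodable α] [Primcodable β] (v : α → ℕ → ℚ) (w : β → ℕ → ℚ) :
    Prop :=
  ∃ T : α → ℕ → List (Coef × β), Primrec₂ T ∧ IsExpansion T v w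

/-- The second expansion is required only at the indices that occur in `T a`, so that an induction
may carry an invariant along. Finitely many indices matter for each n, hence finitely many primes
are lost. -/
theorem IsExpansion.comp_step {α β : Type*} {T : α → ℕ → List (Coef × β)} {v : α → ℕ → ℚ}
    {w : β → ℕ → ℚ} (a : α) (Θ : ℕ → β → ℕ → ℚ)
    (hT : ∀ n, 0 < n → ∀ᶠ p : ℕ in atTop, p.Prime →
      Small p n (v a p - ∑ j ∈ Finset.range n, (p : ℚ) ^ j * lsum (T a j) (w · p)))
    (hΘ : ∀ j, ∀ x ∈ T a j, ∀ n, 0 < n → ∀ᶠ p : ℕ in atTop, p.Prime →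
      Small p n (w x.2 p - ∑ m ∈ Finset.range n, (p : ℚ) ^ m * Θ p x.2 m)) (n : ℕ) (hn : 0 < n) :
    ∀ᶠ p : ℕ in atTop, p.Prime → Small p n (v a p - ∑ l ∈ Finset.range n, (p : ℚ) ^ l *
      ∑ j ∈ Finset.range (l + 1), lsum (T a j) (fun b => Θ p b (l - j))) := by
  have h1 : ∀ᶠ p : ℕ in atTop, ∀ j < n, ∀ x ∈ T a j, p.Prime → Small p 0 (cval x.1) :=
    eventually_lt_list fun j _ x _ => eventually_small_cval x.1
  have h2 : ∀ᶠ p : ℕ in atTop, ∀ j < n, ∀ x ∈ T a j, p.Prime →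
      Small p (n - j) (w x.2 p - ∑ m ∈ Finset.range (n - j), (p : ℚ) ^ m * Θ p x.2 m) :=
    eventually_lt_list fun j hj x hx => hΘ j x hx (n - j) (Nat.sub_pos_of_lt hj)
  filter_upwards [hT n hn, h1, h2] with p h3 h1 h2 hp
  have := (h3 hp).add (small_expansion_comp (T a) (w · p) (Θ p)
    (fun j hj x hx => h1 j hj x hx hp) (fun j hj x hx => h2 j hj x hx hp))
  simpa using this

/-! ### Composition and iteration of effective expansions -/

section expand

variable {α β γ : Type*} [Primcodable α] [Primcodable β] [Primcodable γ]

theorem Expands.trans {v : α → ℕ → ℚ} {w : β → ℕ → ℚ} {u : γ → ℕ → ℚ} (h1 : Expands v w)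
    (h2 : Expands w u) : Expands v u := by
  obtain ⟨S, hS, h1⟩ := h1
  obtain ⟨T, hT, h2⟩ := h2
  refine ⟨fun a l => (List.range (l + 1)).flatMap fun j => (S a j).flatMap fun x =>
    (T x.2 (l - j)).map fun y => (cmul x.1 y.1, y.2), ?_, fun a n hn => ?_⟩
  · refine Primrec.list_flatMap (Primrec.list_range.comp (Primrec.succ.comp Primrec.snd)) ?_
    refine Primrec.list_flatMap
      (hS.comp (Primrec.fst.comp Primrec.fst) Primrec.snd) ?_
    refine Primrec.list_map (hT.comp (Primrec.snd.comp Primrec.snd) (Primrec.nat_sub.comp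
      (Primrec.snd.comp (Primrec.fst.comp Primrec.fst)) (Primrec.snd.comp Primrec.fst))) ?_
    exact Primrec.pair (primrec_cmul.comp (Primrec.fst.comp (Primrec.snd.comp Primrec.fst))
      (Primrec.fst.comp Primrec.snd)) (Primrec.snd.comp Primrec.snd)
  · have := IsExpansion.comp_step a (fun p b m => lsum (T b m) (u · p)) (h1 a)
      (fun j x _ => h2 x.2) n hn
    filter_upwards [this] with p hp hpp
    convert hp hpp using 4
    rw [lsum_flatMap, sum_map_range]
    refine Finset.sum_congr rfl fun j _ => ?_
    rw [lsum_flatMap, lsum]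
    simp_rw [lsum_map_cmul]

/-- One step of the expansion of a work list; the last entry of an item is the exponent of `p`
that is still to be accounted for. -/
def workStep (Λ : ℕ → β → ℕ → List (Coef × β)) (k : ℕ) (W : List (Coef × β × ℕ)) :
    List (Coef × β × ℕ) :=
  W.flatMap fun x => (List.range (x.2.2 + 1)).flatMap fun j =>
    (Λ k x.2.1 j).map fun y => (cmul x.1 y.1, y.2, x.2.2 - j)

/-- `k` steps of the expansion of a work list. -/
def workRun (Λ : ℕ → β → ℕ → List (Coef × β)) (k : ℕ) (W : List (Coef × β × ℕ)) :
    List (Coef × β × ℕ) :=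
  ((fun s : ℕ × List (Coef × β × ℕ) => (s.1 - 1, workStep Λ (s.1 - 1) s.2))^[k] (k, W)).2

/-- The finished items of a work list. -/
def workDone (W : List (Coef × β × ℕ)) : List (Coef × β) :=
  W.flatMap fun x => if x.2.2 = 0 then [(x.1, x.2.1)] else []

omit [Primcodable β] in
theorem workRun_succ (Λ : ℕ → β → ℕ → List (Coef × β)) (k : ℕ) (W : List (Coef × β × ℕ)) :
    workRun Λ (k + 1) W = workRun Λ k (workStep Λ k W) := by
  simp [workRun]

/-- Expanding recursively would call the lower level at varying indices and exponents. Keeping all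
pending items in one list makes it a plain iteration of a map on lists, hence primitive recursive.
-/
theorem primrec_workDone_workRun {Λ : ℕ → β → ℕ → List (Coef × β)}
    (hΛ : Primrec fun x : ℕ × β × ℕ => Λ x.1 x.2.1 x.2.2) :
    Primrec₂ fun (a : ℕ × β) (l : ℕ) => workDone (workRun Λ a.1 [((1, 1), a.2, l)]) := by
  have hstep : Primrec₂ (workStep Λ) := by
    refine Primrec.list_flatMap Primrec.snd ?_
    refine Primrec.list_flatMap (Primrec.list_range.comp (Primrec.succ.comp
      (Primrec.snd.comp (Primrec.snd.comp Primrec.snd)))) ?_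
    refine Primrec.list_map (hΛ.comp (Primrec.pair
      (Primrec.fst.comp (Primrec.fst.comp Primrec.fst)) (Primrec.pair
        (Primrec.fst.comp (Primrec.snd.comp (Primrec.snd.comp Primrec.fst))) Primrec.snd))) ?_
    refine Primrec.pair (primrec_cmul.comp
      (Primrec.fst.comp (Primrec.snd.comp (Primrec.fst.comp Primrec.fst)))
      (Primrec.fst.comp Primrec.snd)) (Primrec.pair (Primrec.snd.comp Primrec.snd)
        (Primrec.nat_sub.comp (Primrec.snd.comp (Primrec.snd.comp
          (Primrec.snd.comp (Primrec.fst.comp Primrec.fst)))) (Primrec.snd.comp Primrec.fst)))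
  have hdone : Primrec (workDone (β := β)) := by
    refine Primrec.list_flatMap Primrec.id ?_
    refine Primrec.ite (Primrec.eq.comp (Primrec.snd.comp (Primrec.snd.comp Primrec.snd))
      (Primrec.const 0)) ?_ (Primrec.const [])
    exact Primrec.list_cons.comp (Primrec.pair (Primrec.fst.comp Primrec.snd)
      (Primrec.fst.comp (Primrec.snd.comp Primrec.snd))) (Primrec.const [])
  refine hdone.comp (Primrec.snd.comp (Primrec.nat_iterate (Primrec.fst.comp Primrec.fst)
    (Primrec.pair (Primrec.fst.comp Primrec.fst) (Primrec.list_cons.comp (Primrec.pair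
      (Primrec.const _) (Primrec.pair (Primrec.snd.comp Primrec.fst) Primrec.snd))
      (Primrec.const []))) ?_))
  have hp : Primrec fun s : ((ℕ × β) × ℕ) × (ℕ × List (Coef × β × ℕ)) => s.2.1 - 1 :=
    Primrec.nat_sub.comp (Primrec.fst.comp Primrec.snd) (Primrec.const 1)
  exact Primrec.pair hp (hstep.comp hp (Primrec.snd.comp Primrec.snd))

omit [Primcodable β] in
-- The items of a work list evolve independently, so the run is linear in the initial list.
theorem lsum_workDone_workRun (Λ : ℕ → β → ℕ → List (Coef × β)) (w : β → ℚ) (k : ℕ)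
    (W : List (Coef × β × ℕ)) :
    lsum (workDone (workRun Λ k W)) w =
      (W.map fun x => cval x.1 * lsum (workDone (workRun Λ k [((1, 1), x.2.1, x.2.2)])) w).sum := by
  induction k generalizing W with
  | zero =>
    simp only [workRun, Function.iterate_zero, id, workDone, lsum_flatMap]
    congr 1
    refine List.map_congr_left fun x _ => ?_
    by_cases h : x.2.2 = 0 <;> simp [h, cval]
  | succ k ih =>
    have key : ∀ W : List (Coef × β × ℕ), lsum (workDone (workRun Λ (k + 1) W)) w =
        (W.map fun x => cval x.1 * ∑ j ∈ Finset.range (x.2.2 + 1), lsum (Λ k x.2.1 j)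
          fun b => lsum (workDone (workRun Λ k [((1, 1), b, x.2.2 - j)])) w).sum := by
      intro W
      rw [workRun_succ, ih]
      induction W with
      | nil => simp [workStep]
      | cons x W ihW =>
        have e : workStep Λ k (x :: W) = workStep Λ k [x] ++ workStep Λ k W := by
          simp [workStep]
        rw [e, List.map_append, List.sum_append, ihW, List.map_cons, List.sum_cons]
        congr 1
        simp only [workStep, List.flatMap_cons, List.flatMap_nil, List.append_nil,
          List.map_flatMap, Finset.mul_sum]
        rw [sum_flatMap, ← sum_map_range]
        congr 1
        refine List.map_congr_left fun j _ => ?_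
        rw [List.map_map, lsum, ← List.sum_map_mul_left]
        congr 1
        refine List.map_congr_left fun y _ => ?_
        simp [cval_cmul, mul_assoc]
    rw [key]
    congr 1
    refine List.map_congr_left fun x _ => ?_
    rw [key]
    simp [cval]

omit [Primcodable β] in
theorem lsum_workDone_workRun_succ (Λ : ℕ → β → ℕ → List (Coef × β)) (w : β → ℚ) (k : ℕ)
    (b : β) (l : ℕ) :
    lsum (workDone (workRun Λ (k + 1) [((1, 1), b, l)])) w =
      ∑ j ∈ Finset.range (l + 1), lsum (Λ k b j)
        fun b' => lsum (workDone (workRun Λ k [((1, 1), b', l - j)])) w := by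
  rw [workRun_succ, lsum_workDone_workRun]
  simp only [workStep, List.flatMap_cons, List.flatMap_nil, List.append_nil, List.map_flatMap]
  rw [sum_flatMap, ← sum_map_range]
  congr 1
  refine List.map_congr_left fun j _ => ?_
  rw [List.map_map, lsum]
  congr 1
  refine List.map_congr_left fun y _ => ?_
  simp [cval_cmul]

/-- A number of steps that depends on the input still gives an effective expansion. The predicate
`Inv` allows the step to be justified only for indices that can be finished in the steps left. -/
theorem Expands.iterate (Λ : ℕ → β → ℕ → List (Coef × β))
    (hΛ : Primrec fun x : ℕ × β × ℕ => Λ x.1 x.2.1 x.2.2) (v : ℕ → β → ℕ → ℚ)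
    (Inv : ℕ → β → Prop)
    (hInv : ∀ k b, Inv (k + 1) b → ∀ j, ∀ x ∈ Λ k b j, Inv k x.2)
    (h : ∀ k b, Inv (k + 1) b → ∀ n, 0 < n → ∀ᶠ p : ℕ in atTop, p.Prime →
      Small p n (v (k + 1) b p - ∑ j ∈ Finset.range n, (p : ℚ) ^ j * lsum (Λ k b j) (v k · p)))
    {g : α → ℕ × β} (hg : Primrec g) (hgI : ∀ a, Inv (g a).1 (g a).2) :
    Expands (fun a => v (g a).1 (g a).2) (v 0) := by
  refine ⟨fun a l => workDone (workRun Λ (g a).1 [((1, 1), (g a).2, l)]),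
    (primrec_workDone_workRun hΛ).comp (hg.comp Primrec.fst) Primrec.snd, fun a => ?_⟩
  have key : ∀ k b, Inv k b → ∀ n, 0 < n → ∀ᶠ p : ℕ in atTop, p.Prime →
      Small p n (v k b p - ∑ l ∈ Finset.range n, (p : ℚ) ^ l *
        lsum (workDone (workRun Λ k [((1, 1), b, l)])) (v 0 · p)) := by
    intro k
    induction k with
    | zero =>
      intro b _ n hn
      refine Eventually.of_forall fun p _ => ?_
      -- With no step left, an item counts only if its whole power of p has been accounted for.
      have e : ∀ l, lsum (workDone (workRun Λ 0 [((1, 1), b, l)])) (v 0 · p) =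
          if l = 0 then v 0 b p else 0 := by
        intro l
        by_cases hl : l = 0 <;> simp [workRun, workDone, hl, cval]
      simp_rw [e]
      simp [hn, Finset.sum_ite_eq', Small.zero_right]
    | succ k ih =>
      intro b hb n hn
      have := IsExpansion.comp_step (T := fun b j => Λ k b j) (v := v (k + 1)) (w := v k) b
        (fun p b m => lsum (workDone (workRun Λ k [((1, 1), b, m)])) (v 0 · p))
        (h k b hb) (fun j x hx n => ih x.2 (hInv k b hb j x hx) n) n hn
      filter_upwards [this] with p hp hpp
      convert hp hpp using 4
      exact lsum_workDone_workRun_succ Λ (v 0 · p) k b _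
  exact key _ _ (hgI a)

end expand

/-- The multiple harmonic sum `H_{p-1}` whose exponents are the successors of the entries of a
list. -/
def harmonicVal (w : List ℕ) (p : ℕ) : ℚ := harmonicSum (w.map Nat.succ) (p - 1)

theorem isComposition_map_succ (w : List ℕ) : IsComposition (w.map Nat.succ) := by
  intro x hx
  obtain ⟨y, _, rfl⟩ := List.mem_map.1 hx
  exact y.succ_pos

/-- The fraction with the same value, and nonzero denominator. -/
def normCoef (c : Coef) : ℤ × ℕ := if c.2 = 0 then (0, 1) else c

theorem normCoef_den_ne_zero (c : Coef) : (normCoef c).2 ≠ 0 := by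
  unfold normCoef; split_ifs with h <;> simp [h]

theorem cval_normCoef (c : Coef) : cval (normCoef c) = cval c := by
  unfold normCoef cval; split_ifs with h <;> simp [h]

theorem primrec_normCoef : Primrec normCoef :=
  Primrec.ite (Primrec.eq.comp Primrec.snd (Primrec.const 0)) (Primrec.const _) Primrec.id

/-- The terms of an expansion with exponent of `p` less than `n`. -/
def termList {α : Type*} (T : α → ℕ → List (Coef × List ℕ)) (a : α) (n : ℕ) : List TermData :=
  (List.range n).flatMap fun l =>
    (T a l).map fun x => (x.2.map Nat.succ, normCoef x.1, (l : ℤ))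

theorem primrec_termList {α : Type*} [Primcodable α] {T : α → ℕ → List (Coef × List ℕ)}
    (hT : Primrec₂ T) : Primrec₂ (termList T) := by
  refine Primrec.list_flatMap (Primrec.list_range.comp Primrec.snd) ?_
  refine Primrec.list_map (hT.comp (Primrec.fst.comp Primrec.fst) Primrec.snd) ?_
  refine Primrec.pair (Primrec.list_map (Primrec.snd.comp Primrec.snd)
    (Primrec.succ.comp Primrec.snd).to₂) (Primrec.pair
      (primrec_normCoef.comp (Primrec.fst.comp Primrec.snd))
      (primrec_int_natCast.comp (Primrec.snd.comp Primrec.fst)))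

theorem valid_of_mem_termList {α : Type*} {T : α → ℕ → List (Coef × List ℕ)} {a : α} {n : ℕ}
    {t : TermData} (ht : t ∈ termList T a n) : t.Valid := by
  simp only [termList, List.mem_flatMap, List.mem_map] at ht
  obtain ⟨l, _, x, _, rfl⟩ := ht
  exact ⟨isComposition_map_succ _, normCoef_den_ne_zero _⟩

theorem sum_termList {α : Type*} (T : α → ℕ → List (Coef × List ℕ)) (a : α) (n p : ℕ) :
    ((termList T a n).map fun t => t.value p).sum =
      ∑ l ∈ Finset.range n, (p : ℚ) ^ l * lsum (T a l) (harmonicVal · p) := by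
  rw [termList, List.map_flatMap, sum_flatMap, sum_map_range]
  refine Finset.sum_congr rfl fun l _ => ?_
  rw [List.map_map, lsum, ← List.sum_map_mul_left]
  congr 1
  refine List.map_congr_left fun x _ => ?_
  have := cval_normCoef x.1
  simp only [cval] at this
  simp only [Function.comp_apply, TermData.value, this, zpow_natCast, harmonicVal, cval]
  ring

/-! ### Convergence in `QInfty` and membership in the MHS algebra -/

theorem mk_mem_Fil {a : boundedSeq} {n : ℤ}
    (h : ∀ᶠ p : Nat.Primes in cofinite, ‖a.1 p‖ ≤ ((p : ℕ) : ℝ) ^ (-n)) :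
    QInfty.mk a ∈ QInfty.Fil n := ⟨a, h, rfl⟩

theorem eventually_primes {P : ℕ → Prop} (h : ∀ᶠ p : ℕ in atTop, p.Prime → P p) :
    ∀ᶠ p : Nat.Primes in cofinite, P p := by
  have h1 : Tendsto (fun p : Nat.Primes => (p : ℕ)) cofinite cofinite :=
    Subtype.val_injective.tendsto_cofinite
  rw [Nat.cofinite_eq_atTop] at h1
  filter_upwards [h1.eventually h] with p hp
  exact hp p.2

theorem Fil_small {a : ℕ → ℚ} {n : ℕ} (ha : BoundedBelow (ratSeq a))
    (h : ∀ᶠ p : ℕ in atTop, p.Prime → Small p n (a p)) :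
    QInfty.mk ⟨ratSeq a, ha⟩ ∈ QInfty.Fil n := by
  refine mk_mem_Fil ?_
  filter_upwards [eventually_primes h] with p hp
  exact hp.norm_le

theorem term_mem_Fil (c : ℚ) (b : ℤ) (s : List ℕ) : QInfty.term c b s ∈ QInfty.Fil b := by
  refine mk_mem_Fil ?_
  have h : ∀ᶠ p : ℕ in atTop, p.Prime → c.den < p := by
    filter_upwards [eventually_gt_atTop c.den] with p hp _ using hp
  filter_upwards [eventually_primes h] with p hp
  have h0 : ‖(c : ℚ_[p])‖ ≤ ((p : ℕ) : ℝ) ^ (-(0 : ℤ)) := by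
    rw [neg_zero, zpow_zero]
    exact Padic.norm_rat_le_one fun hd => absurd (Nat.le_of_dvd c.pos hd) (by omega)
  have h1 : ‖((((p : ℕ) : ℚ) ^ b : ℚ) : ℚ_[p])‖ ≤ ((p : ℕ) : ℝ) ^ (-b) := by
    push_cast
    exact (Padic.norm_p_zpow b).le
  have h2 : ‖((harmonicSum s (p - 1) : ℚ) : ℚ_[p])‖ ≤ ((p : ℕ) : ℝ) ^ (-(0 : ℤ)) := by
    rw [neg_zero, zpow_zero]
    exact norm_harmonicSum_le p s _ (Nat.sub_lt p.2.pos one_pos)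
  have h3 := norm_mul_bound (norm_mul_bound h0 h1) h2
  simpa [ratSeq] using h3

theorem sum_term_sub_mem_Fil {ι : Type*} (s : Finset ι) (c : ι → ℚ) (b : ι → ℤ)
    (w : ι → List ℕ) {a : ℕ → ℚ} (ha : BoundedBelow (ratSeq a)) {n : ℕ}
    (h : ∀ᶠ p : ℕ in atTop, p.Prime →
      Small p n (a p - ∑ i ∈ s, c i * (p : ℚ) ^ b i * harmonicSum (w i) (p - 1))) :
    ∑ i ∈ s, QInfty.term (c i) (b i) (w i) - QInfty.mk ⟨ratSeq a, ha⟩ ∈ QInfty.Fil n := by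
  simp only [QInfty.term]
  rw [← map_sum, ← map_sub, ← neg_sub, map_neg]
  refine neg_mem (mk_mem_Fil ?_)
  filter_upwards [eventually_primes h] with p hp
  have := hp.norm_le
  simpa [ratSeq, Finset.sum_apply] using this

/-- A series that converges to `(a p)_p`, from the data of its terms by levels. -/
theorem mem_mhsAlgebra_of_levels {a : ℕ → ℚ} (ha : BoundedBelow (ratSeq a))
    (T : ℕ → List (Coef × List ℕ))
    (h : ∀ n, 0 < n → ∀ᶠ p : ℕ in atTop, p.Prime →
      Small p n (a p - ∑ j ∈ Finset.range n, (p : ℚ) ^ j * lsum (T j) (harmonicVal · p))) :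
    QInfty.mk ⟨ratSeq a, ha⟩ ∈ mhsAlgebra := by
  classical
  let good : ℕ → Prop := fun i => i.unpair.2 < (T i.unpair.1).length
  let item : ℕ → Coef × List ℕ := fun i => (T i.unpair.1).getD i.unpair.2 ((0, 1), [])
  let c : ℕ → ℚ := fun i => if good i then cval (item i).1 else 0
  -- Indices are pairs (level, position). Pairs beyond the end of a level get coefficient 0, and
  -- exponent i so that the exponents still tend to infinity.
  let b : ℕ → ℤ := fun i => if good i then (i.unpair.1 : ℤ) else i
  let w : ℕ → List ℕ := fun i => (item i).2.map Nat.succ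
  let S : ℕ → Finset ℕ := fun n =>
    ((Finset.range n).sigma fun l => Finset.range (T l).length).image fun x => Nat.pair x.1 x.2
  have hS : ∀ n i, i ∈ S n ↔ good i ∧ i.unpair.1 < n := by
    intro n i
    simp only [S, Finset.mem_image, Finset.mem_sigma, Finset.mem_range, good]
    constructor
    · rintro ⟨⟨l, m⟩, ⟨h1, h2⟩, rfl⟩
      simpa using ⟨h2, h1⟩
    · rintro ⟨h1, h2⟩
      exact ⟨⟨i.unpair.1, i.unpair.2⟩, ⟨h2, h1⟩, Nat.pair_unpair i⟩
  have hterm : ∀ n i, i ∉ S n → QInfty.term (c i) (b i) (w i) ∈ QInfty.Fil n := by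
    intro n i hi
    rw [hS] at hi
    by_cases hg : good i
    · have h1 : (n : ℤ) ≤ b i := by simp only [b, hg, if_true]; push Not at hi; exact_mod_cast hi hg
      exact QInfty.Fil_mono h1 (term_mem_Fil _ _ _)
    · have h1 : c i = 0 := by simp [c, hg]
      rw [h1]
      refine Fil_small _ (Eventually.of_forall fun p _ => ?_)
      simpa using Small.zero_right p n
  refine ⟨c, b, w, ?_, fun i => isComposition_map_succ _, ?_⟩
  · refine tendsto_atTop.2 fun B => ?_
    have h1 : ∀ᶠ i : ℕ in atTop, i ∉ S B.toNat := by
      rw [← Nat.cofinite_eq_atTop]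
      exact (S B.toNat).finite_toSet.compl_mem_cofinite
    filter_upwards [h1, eventually_ge_atTop B.toNat] with i h1 h2
    rw [hS] at h1
    by_cases hg : good i
    · have : ¬ i.unpair.1 < B.toNat := fun h => h1 ⟨hg, h⟩
      simp only [b, hg, if_true]; omega
    · simp only [b, hg, if_false]; omega
  · have hb := QInfty.ringSubgroupsBasis.hasBasis_nhds (QInfty.mk ⟨ratSeq a, ha⟩)
    change Tendsto _ _ _
    refine hb.tendsto_right_iff.2 fun N _ => ?_
    obtain ⟨n, hn, hNn⟩ : ∃ n : ℕ, 0 < n ∧ N ≤ n := ⟨N.toNat + 1, by omega, by omega⟩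
    -- A partial sum containing all terms of level below n differs from the truncation only by
    -- elements of `Fil n`, so convergence is unconditional.
    refine (eventually_ge_atTop (S n)).mono fun s hs => ?_
    refine QInfty.Fil_mono hNn ?_
    rw [← Finset.sum_sdiff hs, add_sub_assoc]
    refine add_mem (sum_mem fun i hi => hterm n i (Finset.mem_sdiff.1 hi).2) ?_
    refine sum_term_sub_mem_Fil _ _ _ _ ha ?_
    filter_upwards [h n hn] with p hp hpp
    convert hp hpp using 2
    rw [Finset.sum_image, Finset.sum_sigma]
    · refine Finset.sum_congr rfl fun l _ => ?_
      have e : lsum (T l) (harmonicVal · p) = ∑ i ∈ Finset.range (T l).length,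
          cval ((T l).getD i ((0, 1), [])).1 * harmonicVal ((T l).getD i ((0, 1), [])).2 p := by
        rw [lsum, ← sum_map_range]
        congr 1
        refine List.ext_getElem (by simp) fun i h1 h2 => ?_
        simp at h1
        simp [h1]
      rw [e, Finset.mul_sum]
      refine Finset.sum_congr rfl fun i hi => ?_
      have hg : good (Nat.pair l i) := by simpa [good] using Finset.mem_range.1 hi
      simp only [c, b, w, hg, if_true, item, Nat.unpair_pair, harmonicVal, zpow_natCast]
      ring
    · rintro ⟨x, y⟩ _ ⟨x', y'⟩ _ hxy
      have := Nat.pair_eq_pair.1 hxy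
      simp only at this
      obtain ⟨rfl, rfl⟩ := this
      rfl

theorem main_of_expands
    (H : Expands (fun (a : ℕ × ℕ) p => curiousSum (a.1 + 1) (a.2 + 1) p) harmonicVal) :
    (∃ E : ℕ × ℕ × ℕ → List TermData, Computable E ∧
      ∀ r k n : ℕ, 0 < r → 0 < k → 0 < n →
        (∀ t ∈ E (r, k, n), t.Valid) ∧
        ∃ p₀ : ℕ, ∀ p : ℕ, p₀ ≤ p → p.Prime →
          RatModEq (p ^ n) (curiousSum r k p) ((E (r, k, n)).map fun t => t.value p).sum) ∧
    (∀ r k : ℕ, 0 < r → 0 < k → QInfty.curious r k ∈ mhsAlgebra) := by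
  obtain ⟨T, hT, h⟩ := H
  refine ⟨⟨fun x => termList T (x.1 - 1, x.2.1 - 1) x.2.2, Primrec.to_comp ?_, ?_⟩, ?_⟩
  · refine (primrec_termList hT).comp (Primrec.pair (Primrec.nat_sub.comp Primrec.fst
      (Primrec.const 1)) (Primrec.nat_sub.comp (Primrec.fst.comp Primrec.snd)
      (Primrec.const 1))) (Primrec.snd.comp Primrec.snd)
  · intro r k n hr hk hn
    refine ⟨fun t ht => valid_of_mem_termList ht, ?_⟩
    obtain ⟨p₀, hp⟩ := eventually_atTop.1 (h (r - 1, k - 1) n hn)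
    refine ⟨p₀, fun p hpp hp' => Small.ratModEq ?_⟩
    have := hp p hpp hp'
    rw [sum_termList]
    simpa [Nat.sub_add_cancel hr, Nat.sub_add_cancel hk] using this
  · intro r k hr hk
    refine mem_mhsAlgebra_of_levels (boundedBelow_curiousSum r k) (T (r - 1, k - 1)) fun n hn => ?_
    have := h (r - 1, k - 1) n hn
    simpa [Nat.sub_add_cancel hr, Nat.sub_add_cancel hk] using this

/-! ### Nested sums with a marked variable -/

/-- `∑ α₁^{-s₁-1} ⋯ α_l^{-s_l-1} Ψ(x)` over `y > α₁ > ⋯ > α_l > x ≥ 0`. -/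
def chain : List ℕ → (ℕ → ℚ) → ℕ → ℚ
  | [], Ψ, y => ∑ x ∈ Finset.range y, Ψ x
  | s :: t, Ψ, y => ∑ α ∈ Finset.range y, ((α : ℚ) ^ (s + 1))⁻¹ * chain t Ψ α

/-- The indicator function of `0`. -/
def delta (x : ℕ) : ℚ := if x = 0 then 1 else 0

@[simp] theorem chain_zero (L : List ℕ) (Ψ : ℕ → ℚ) : chain L Ψ 0 = 0 := by
  cases L <;> simp [chain]

theorem chain_congr (L : List ℕ) {Ψ Φ : ℕ → ℚ} {y : ℕ} (h : ∀ x < y, Ψ x = Φ x) :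
    chain L Ψ y = chain L Φ y := by
  induction L generalizing y with
  | nil => exact Finset.sum_congr rfl fun x hx => h x (Finset.mem_range.1 hx)
  | cons s t ih =>
    refine Finset.sum_congr rfl fun a ha => ?_
    rw [ih fun x hx => h x (hx.trans (Finset.mem_range.1 ha))]

theorem chain_sum {ι : Type*} (I : Finset ι) (L : List ℕ) (Ψ : ι → ℕ → ℚ) (y : ℕ) :
    chain L (fun x => ∑ i ∈ I, Ψ i x) y = ∑ i ∈ I, chain L (Ψ i) y := by
  induction L generalizing y with
  | nil => exact Finset.sum_comm
  | cons s t ih =>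
    simp only [chain, ih, Finset.mul_sum]
    exact Finset.sum_comm

theorem chain_add (L : List ℕ) (Ψ Φ : ℕ → ℚ) (y : ℕ) :
    chain L (fun x => Ψ x + Φ x) y = chain L Ψ y + chain L Φ y := by
  induction L generalizing y with
  | nil => exact Finset.sum_add_distrib
  | cons s t ih => simp only [chain, ih, mul_add, Finset.sum_add_distrib]

theorem chain_mul_left (L : List ℕ) (c : ℚ) (Ψ : ℕ → ℚ) (y : ℕ) :
    chain L (fun x => c * Ψ x) y = c * chain L Ψ y := by
  induction L generalizing y with
  | nil => exact (Finset.mul_sum _ _ _).symm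
  | cons s t ih =>
    simp only [chain, ih, Finset.mul_sum]
    exact Finset.sum_congr rfl fun _ _ => by ring

theorem chain_sub (L : List ℕ) (Ψ Φ : ℕ → ℚ) (y : ℕ) :
    chain L (fun x => Ψ x - Φ x) y = chain L Ψ y - chain L Φ y := by
  have := chain_add L Ψ (fun x => -1 * Φ x) y
  rw [chain_mul_left] at this
  rw [show chain L Ψ y - chain L Φ y = chain L Ψ y + -1 * chain L Φ y by ring, ← this]
  exact chain_congr L fun x _ => by ring

theorem chain_zero_right (L : List ℕ) (y : ℕ) : chain L (fun _ => 0) y = 0 := by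
  have := chain_mul_left L 0 (fun _ => 0) y
  simpa using this

theorem chain_list_sum {ι : Type*} (l : List ι) (L : List ℕ) (Ψ : ι → ℕ → ℚ) (y : ℕ) :
    chain L (fun x => (l.map fun i => Ψ i x).sum) y = (l.map fun i => chain L (Ψ i) y).sum := by
  induction l with
  | nil => simpa using chain_zero_right L y
  | cons i l ih => simp [chain_add, ih]

theorem chain_append (L R : List ℕ) (s : ℕ) (Ψ : ℕ → ℚ) (y : ℕ) :
    chain (L ++ s :: R) Ψ y = chain L (fun x => ((x : ℚ) ^ (s + 1))⁻¹ * chain R Ψ x) y := by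
  induction L generalizing y with
  | nil => rfl
  | cons a t ih => simp only [List.cons_append, chain, ih]

theorem chain_small {p n y : ℕ} (hp : p.Prime) (hy : y ≤ p) (L : List ℕ) {Ψ : ℕ → ℚ}
    (h : ∀ x < y, Small p n (Ψ x)) : Small p n (chain L Ψ y) := by
  induction L generalizing y with
  | nil => exact Small.sum fun x hx => h x (Finset.mem_range.1 hx)
  | cons s t ih =>
    refine Small.sum fun a ha => ?_
    have ha' := Finset.mem_range.1 ha
    rcases Nat.eq_zero_or_pos a with rfl | h0
    · simpa using Small.zero_right p n
    refine Small.mul_left ?_ (ih (by omega) fun x hx => h x (hx.trans ha'))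
    rw [← inv_pow]
    exact (Small.inv_natCast hp fun hd => absurd (Nat.le_of_dvd h0 hd) (by omega)).pow _

/-- A multiple harmonic sum is a chain whose last, unweighted variable is pinned to 0. The bound
shifts by 1 because chains run strictly below their argument. -/
theorem harmonicSum_eq_chain (w : List ℕ) (N : ℕ) :
    harmonicSum (w.map Nat.succ) N = chain w delta (N + 1) := by
  induction w generalizing N with
  | nil => simp [harmonicSum, chain, delta]
  | cons s t ih =>
    rw [List.map_cons, harmonicSum, chain, Finset.sum_range_succ', chain_zero, mul_zero, add_zero,
      ← Finset.sum_image (s := Finset.range N) (g := fun a => a + 1)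
        (f := fun a : ℕ => ((a : ℚ) ^ (s + 1))⁻¹ * chain t delta a) (by simp)]
    have e : (Finset.range N).image (fun a => a + 1) = Finset.Icc 1 N := by
      ext x
      simp only [Finset.mem_image, Finset.mem_range, Finset.mem_Icc]
      constructor
      · rintro ⟨a, h, rfl⟩; omega
      · rintro ⟨h1, h2⟩; exact ⟨x - 1, by omega, by omega⟩
    rw [e]
    refine Finset.sum_congr rfl fun m hm => ?_
    rw [ih, Nat.sub_add_cancel (Finset.mem_Icc.1 hm).1, one_div]

theorem harmonicVal_eq_chain (w : List ℕ) {p : ℕ} (hp : 0 < p) :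
    harmonicVal w p = chain w delta p := by
  rw [harmonicVal, harmonicSum_eq_chain, Nat.sub_add_cancel hp]

/-- The ways of placing a new variable relative to a chain of variables: the entries before it,
its exponent, the entries after it. -/
def insertions : List ℕ → List (List ℕ × ℕ × List ℕ)
  | [] => [([], 0, [])]
  | s :: t => ([], 0, s :: t) :: ([], s + 1, t) ::
      (insertions t).map fun x => (s :: x.1, x.2.1, x.2.2)

theorem sum_range_sum_Ioo (y : ℕ) (f : ℕ → ℕ → ℚ) :
    ∑ x ∈ Finset.range y, ∑ b ∈ Finset.Ioo x y, f x b =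
      ∑ b ∈ Finset.range y, ∑ x ∈ Finset.range b, f x b := by
  refine Finset.sum_comm' fun a b => ?_
  simp only [Finset.mem_range, Finset.mem_Ioo]
  omega

/-- The stuffle of a chain with one further variable b: relative to the top entry a, either b < a
and b is inserted further down, or b = a and the exponents merge, or b > a and b heads the chain. -/
theorem chain_mul_sum_Ioo (L : List ℕ) (Ψ h : ℕ → ℚ) (y : ℕ) :
    chain L (fun x => Ψ x * ∑ b ∈ Finset.Ioo x y, h b) y =
      ((insertions L).map fun i =>
        chain i.1 (fun b => h b * ((b : ℚ) ^ i.2.1)⁻¹ * chain i.2.2 Ψ b) y).sum := by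
  induction L generalizing y with
  | nil =>
    simp only [insertions, chain, List.map_cons, List.map_nil, List.sum_cons, List.sum_nil,
      add_zero, Finset.mul_sum, pow_zero, inv_one, mul_one]
    rw [sum_range_sum_Ioo]
    exact Finset.sum_congr rfl fun _ _ => Finset.sum_congr rfl fun _ _ => mul_comm _ _
  | cons s t ih =>
    have h1 : ∀ a < y, chain t (fun x => Ψ x * ∑ b ∈ Finset.Ioo x y, h b) a =
        chain t (fun x => Ψ x * ∑ b ∈ Finset.Ioo x a, h b) a + h a * chain t Ψ a +
          chain t Ψ a * ∑ b ∈ Finset.Ioo a y, h b := by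
      intro a ha
      rw [← chain_mul_left, mul_comm (chain t Ψ a), ← chain_mul_left, ← chain_add, ← chain_add]
      refine chain_congr t fun x hx => ?_
      have e : Finset.Ioo x y = Finset.Ioo x a ∪ ({a} ∪ Finset.Ioo a y) := by
        ext b; simp only [Finset.mem_Ioo, Finset.mem_union, Finset.mem_singleton]; omega
      rw [e, Finset.sum_union, Finset.sum_union, Finset.sum_singleton]
      · ring
      · simp
      · rw [Finset.disjoint_left]
        intro b; simp only [Finset.mem_Ioo, Finset.mem_union, Finset.mem_singleton]; omega
    have h2 : chain (s :: t) (fun x => Ψ x * ∑ b ∈ Finset.Ioo x y, h b) y =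
        ∑ a ∈ Finset.range y, ((a : ℚ) ^ (s + 1))⁻¹ *
          chain t (fun x => Ψ x * ∑ b ∈ Finset.Ioo x a, h b) a +
        ∑ a ∈ Finset.range y, h a * ((a : ℚ) ^ (s + 1))⁻¹ * chain t Ψ a +
        ∑ a ∈ Finset.range y, h a * chain (s :: t) Ψ a := by
      have h3 : ∑ a ∈ Finset.range y, h a * chain (s :: t) Ψ a =
          ∑ a ∈ Finset.range y, ((a : ℚ) ^ (s + 1))⁻¹ *
            (chain t Ψ a * ∑ b ∈ Finset.Ioo a y, h b) := by
        simp only [chain, Finset.mul_sum]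
        rw [← sum_range_sum_Ioo y fun a b => h b * (((a : ℚ) ^ (s + 1))⁻¹ * chain t Ψ a)]
        exact Finset.sum_congr rfl fun _ _ => Finset.sum_congr rfl fun _ _ => by ring
      rw [h3, ← Finset.sum_add_distrib, ← Finset.sum_add_distrib]
      refine Finset.sum_congr rfl fun a ha => ?_
      rw [h1 a (Finset.mem_range.1 ha)]
      ring
    rw [h2]
    simp only [insertions, List.map_cons, List.map_map, List.sum_cons]
    have h4 : ∑ a ∈ Finset.range y, ((a : ℚ) ^ (s + 1))⁻¹ *
          chain t (fun x => Ψ x * ∑ b ∈ Finset.Ioo x a, h b) a =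
        ((insertions t).map ((fun i =>
          chain i.1 (fun b => h b * ((b : ℚ) ^ i.2.1)⁻¹ * chain i.2.2 Ψ b) y) ∘
            fun x => (s :: x.1, x.2.1, x.2.2))).sum := by
      have h5 := chain_list_sum (insertions t) []
        (fun i a => ((a : ℚ) ^ (s + 1))⁻¹ *
          chain i.1 (fun b => h b * ((b : ℚ) ^ i.2.1)⁻¹ * chain i.2.2 Ψ b) a) y
      refine Eq.trans ?_ h5
      refine Finset.sum_congr rfl fun a _ => ?_
      rw [ih, ← List.sum_map_mul_left]
    rw [h4]
    simp only [chain, pow_zero, inv_one, mul_one]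
    ring

/-! ### The generating series -/

open PowerSeries

/-- `∑_{0 < n < p} X ^ n / n ^ s`. -/
noncomputable def unitSeries (p s : ℕ) : ℚ⟦X⟧ :=
  PowerSeries.mk fun n => if 0 < n ∧ n < p then ((n : ℚ) ^ s)⁻¹ else 0

/-- The product of the series `unitSeries p (s + 1)`, `s ∈ F`. -/
noncomputable def unitProd (p : ℕ) (F : List ℕ) : ℚ⟦X⟧ := (F.map fun s => unitSeries p (s + 1)).prod

/-- `∑ a₁^{-s₁-1} ⋯ a_m^{-s_m-1}` over `0 < a_i < p` with `a₁ + ⋯ + a_m = U`. -/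
noncomputable def unitSum (p : ℕ) (F : List ℕ) (U : ℕ) : ℚ := coeff U (unitProd p F)

@[simp] theorem unitProd_nil (p : ℕ) : unitProd p [] = 1 := rfl

@[simp] theorem unitProd_cons (p s : ℕ) (F : List ℕ) :
    unitProd p (s :: F) = unitSeries p (s + 1) * unitProd p F := by simp [unitProd]

/-- All coefficients lie in `ℤ_(p)`. -/
def IntegralSeries (p : ℕ) (f : ℚ⟦X⟧) : Prop := ∀ n, Small p 0 (coeff n f)

theorem IntegralSeries.mul {p : ℕ} {f g : ℚ⟦X⟧} (hf : IntegralSeries p f)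
    (hg : IntegralSeries p g) : IntegralSeries p (f * g) := fun n => by
  rw [coeff_mul]
  exact Small.sum fun x _ => (hf _).mul_left (hg _)

theorem IntegralSeries.one (p : ℕ) : IntegralSeries p 1 := fun n => by
  rw [coeff_one]
  split_ifs
  · exact Small.one p
  · exact Small.zero_right p 0

theorem IntegralSeries.pow {p : ℕ} {f : ℚ⟦X⟧} (hf : IntegralSeries p f) (k : ℕ) :
    IntegralSeries p (f ^ k) := by
  induction k with
  | zero => simpa using IntegralSeries.one p
  | succ k ih => rw [pow_succ]; exact ih.mul hf

theorem Small.inv_lt {p x : ℕ} (hp : p.Prime) (h0 : 0 < x) (h : x < p) :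
    Small p 0 ((x : ℚ)⁻¹) :=
  Small.inv_natCast hp fun hd => absurd (Nat.le_of_dvd h0 hd) (by omega)

theorem integral_unitSeries {p : ℕ} (hp : p.Prime) (s : ℕ) : IntegralSeries p (unitSeries p s) := by
  intro n
  rw [unitSeries, coeff_mk]
  split_ifs with h
  · rw [← inv_pow]; exact (Small.inv_lt hp h.1 h.2).pow s
  · exact Small.zero_right p 0

theorem integral_unitProd {p : ℕ} (hp : p.Prime) (F : List ℕ) :
    IntegralSeries p (unitProd p F) := by
  induction F with
  | nil => exact IntegralSeries.one p
  | cons s F ih => rw [unitProd_cons]; exact (integral_unitSeries hp _).mul ih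

theorem small_unitSum {p : ℕ} (hp : p.Prime) (F : List ℕ) (U : ℕ) : Small p 0 (unitSum p F U) :=
  integral_unitProd hp F U

theorem coeff_unitSeries_mul (p s U : ℕ) (Y : ℚ⟦X⟧) :
    coeff U (unitSeries p s * Y) =
      ∑ i ∈ Finset.range (U + 1), (if 0 < i ∧ i < p then ((i : ℚ) ^ s)⁻¹ else 0) *
        coeff (U - i) Y := by
  rw [coeff_mul, Finset.Nat.sum_antidiagonal_eq_sum_range_succ_mk]
  simp [unitSeries]

/-- Substitute b = p - a for the variable a of the first factor; the total left for the other
factors is then p q + b. -/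
theorem coeff_unitSeries_mul_of_dvd (p s q : ℕ) (Y : ℚ⟦X⟧) :
    coeff (p * (q + 1)) (unitSeries p s * Y) =
      ∑ b ∈ Finset.Ioo 0 p, (((p : ℚ) - b) ^ s)⁻¹ * coeff (p * q + b) Y := by
  rw [coeff_unitSeries_mul]
  simp only [ite_mul, zero_mul]
  rw [← Finset.sum_filter]
  refine Finset.sum_nbij' (fun i => p - i) (fun b => p - b) ?_ ?_ ?_ ?_ ?_
  · intro i; simp only [Finset.mem_filter, Finset.mem_range, Finset.mem_Ioo]; omega
  · intro i; simp only [Finset.mem_filter, Finset.mem_range, Finset.mem_Ioo]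
    intro h
    have : p ≤ p * (q + 1) := Nat.le_mul_of_pos_right p q.succ_pos
    omega
  · intro i; simp only [Finset.mem_filter, Finset.mem_range]; omega
  · intro i; simp only [Finset.mem_Ioo]; omega
  · intro i; simp only [Finset.mem_filter, Finset.mem_range]
    rintro ⟨_, h1, h2⟩
    rw [Nat.cast_sub h2.le, sub_sub_cancel]
    congr 3
    rw [mul_add]; omega

/-- A variable with exponent 0 only shifts the total by 1, …, p - 1. The window of totals below p q
+ x is cut at p q; below the cut the remainders are those greater than x, and for q = 0 there are
none. -/
theorem coeff_unitSeries_zero_mul {p x : ℕ} (hx : x < p) (q : ℕ) (Y : ℚ⟦X⟧) :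
    coeff (p * q + x) (unitSeries p 0 * Y) =
      ∑ b ∈ Finset.range x, coeff (p * q + b) Y +
        (if q = 0 then 0 else ∑ b ∈ Finset.Ioo x p, coeff (p * (q - 1) + b) Y) := by
  have h1 : coeff (p * q + x) (unitSeries p 0 * Y) =
      ∑ m ∈ Finset.Ico (p * q + x + 1 - p) (p * q + x), coeff m Y := by
    rw [coeff_unitSeries_mul]
    simp only [ite_mul, zero_mul, pow_zero, inv_one, one_mul]
    rw [← Finset.sum_filter]
    refine Finset.sum_nbij' (fun i => p * q + x - i) (fun b => p * q + x - b) ?_ ?_ ?_ ?_ ?_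
    · intro i; simp only [Finset.mem_filter, Finset.mem_range, Finset.mem_Ico]; omega
    · intro i; simp only [Finset.mem_filter, Finset.mem_range, Finset.mem_Ico]; omega
    · intro i; simp only [Finset.mem_filter, Finset.mem_range]; omega
    · intro i; simp only [Finset.mem_Ico]; omega
    · intro i _; rfl
  rw [h1]
  cases q with
  | zero =>
    have : x + 1 - p = 0 := by omega
    simp [this]
  | succ q =>
    have e1 : p * (q + 1) + x + 1 - p = (x + 1) + p * q := by rw [mul_add]; omega
    have e2 : p * (q + 1) = p + p * q := by ring
    rw [e1, ← Finset.sum_Ico_consecutive _ (show x + 1 + p * q ≤ p + p * q by omega)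
      (show p + p * q ≤ p * (q + 1) + x by omega), e2, add_comm]
    congr 1
    · rw [Finset.sum_Ico_eq_sum_range]
      simp
    · rw [← Finset.sum_Ico_add', if_neg q.succ_ne_zero]
      have : Finset.Ico (x + 1) p = Finset.Ioo x p := by
        ext b; simp only [Finset.mem_Ico, Finset.mem_Ioo]; omega
      rw [this]
      simp [add_comm]

/-- The ways of lowering one exponent by `1`; the flag says whether an exponent has become `0`, in
which case it has been removed. -/
def lowerings : List ℕ → List (Bool × List ℕ)
  | [] => []
  | s :: t => (if s = 0 then (true, t) else (false, (s - 1) :: t)) ::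
      (lowerings t).map fun x => (x.1, s :: x.2)

theorem X_mul_derivative_unitSeries (p s : ℕ) :
    X * d⁄dX ℚ (unitSeries p (s + 1)) = unitSeries p s := by
  ext n
  cases n with
  | zero => simp [unitSeries]
  | succ n =>
    rw [coeff_succ_X_mul, coeff_derivative, unitSeries, unitSeries, coeff_mk, coeff_mk]
    split_ifs with h
    · have : ((n + 1 : ℕ) : ℚ) ≠ 0 := by positivity
      push_cast at this ⊢
      field_simp
      ring
    · simp

/-- The Leibniz rule: the Euler operator hits one factor at a time and lowers its exponent by 1. -/
theorem X_mul_derivative_unitProd (p : ℕ) (F : List ℕ) :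
    X * d⁄dX ℚ (unitProd p F) = ((lowerings F).map fun x =>
      if x.1 then unitSeries p 0 * unitProd p x.2 else unitProd p x.2).sum := by
  induction F with
  | nil => simp [lowerings]
  | cons s F ih =>
    rw [unitProd_cons, Derivation.leibniz, smul_eq_mul, smul_eq_mul, mul_add, mul_left_comm, ih,
      mul_left_comm X, X_mul_derivative_unitSeries, lowerings, List.map_cons, List.sum_cons,
      ← List.sum_map_mul_left, List.map_map, add_comm]
    congr 1
    · cases s <;> simp [mul_comm]
    · congr 1
      refine List.map_congr_left fun x _ => ?_
      simp only [Function.comp_apply, unitProd_cons]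
      split_ifs <;> ring

/-- The Euler operator multiplies the coefficient at N by N. Comparing with the Leibniz rule trades
the total N = p q + x for a lowered exponent, and every exponent that reaches 0 disappears together
with its variable. -/
theorem mul_unitSum {p x : ℕ} (hx : x < p) (q : ℕ) (F : List ℕ) :
    ((p : ℚ) * q + x) * unitSum p F (p * q + x) = ((lowerings F).map fun i =>
      if i.1 then ∑ b ∈ Finset.range x, unitSum p i.2 (p * q + b) +
        (if q = 0 then 0 else ∑ b ∈ Finset.Ioo x p, unitSum p i.2 (p * (q - 1) + b))
      else unitSum p i.2 (p * q + x)).sum := by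
  have h1 : coeff (p * q + x) (X * d⁄dX ℚ (unitProd p F)) =
      ((p : ℚ) * q + x) * unitSum p F (p * q + x) := by
    rw [unitSum]
    generalize unitProd p F = f
    have : ((p : ℚ) * q + x) = ((p * q + x : ℕ) : ℚ) := by push_cast; ring
    rw [this]
    cases (p * q + x) with
    | zero => simp
    | succ n => rw [coeff_succ_X_mul, coeff_derivative]; push_cast; ring
  rw [← h1, X_mul_derivative_unitProd]
  rw [map_list_sum, List.map_map]
  congr 1
  refine List.map_congr_left fun i _ => ?_
  simp only [Function.comp_apply]
  split_ifs with h2 h3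
  · rw [coeff_unitSeries_zero_mul hx, if_pos h3]; rfl
  · rw [coeff_unitSeries_zero_mul hx, if_neg h3]; rfl
  · rfl

theorem unitSum_cons_of_dvd (p s q : ℕ) (F : List ℕ) :
    unitSum p (s :: F) (p * (q + 1)) =
      ∑ b ∈ Finset.Ioo 0 p, (((p : ℚ) - b) ^ (s + 1))⁻¹ * unitSum p F (p * q + b) := by
  rw [unitSum, unitProd_cons, coeff_unitSeries_mul_of_dvd]; rfl

theorem unitSum_cons_zero (p s : ℕ) (F : List ℕ) : unitSum p (s :: F) 0 = 0 := by
  rw [unitSum, unitProd_cons, coeff_unitSeries_mul]; simp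

/-! ### Reduction of the sums `unitSum` to multiple harmonic sums -/

theorem sum_range_level_zero {β : Type*} {n : ℕ} (hn : 0 < n) (p : ℚ) (l : List (Coef × β))
    (w : β → ℚ) :
    ∑ j ∈ Finset.range n, p ^ j * lsum (if j = 0 then l else []) w = lsum l w := by
  rw [Finset.sum_eq_single 0]
  · simp
  · intro j _ hj; simp [hj]
  · intro h; simp at h; omega

theorem lsum_map_pair {β : Type*} (c : Coef) (l : List β) (w : β → ℚ) :
    lsum (l.map fun b => (c, b)) w = cval c * (l.map w).sum := by
  rw [lsum, List.map_map, ← List.sum_map_mul_left]; rfl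

/-- All p-adic expansions of reciprocals come from this finite geometric series, with z = p q or z =
-p; the remainder carries z^n. -/
theorem inv_sub_geom_sum {x z : ℚ} (hx : x ≠ 0) (hu : x + z ≠ 0) (n : ℕ) :
    (x + z)⁻¹ - ∑ j ∈ Finset.range n, (-z) ^ j * (x ^ (j + 1))⁻¹ =
      (-z) ^ n * (x ^ n)⁻¹ * (x + z)⁻¹ := by
  induction n with
  | zero => simp
  | succ n ih =>
    rw [Finset.sum_range_succ, ← sub_sub, ih]
    field_simp
    ring

/-- A state `(L, (q, F), o)`. If `o` is empty it stands for the product of the multiple harmonic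
sum of `L` and of the sum of the terms `∏ a_i^{-F_i-1}` with `∑ a_i = p q`. If `o = (e, t, R)`, it
stands for a multiple harmonic sum with a marked variable `x` between `L` and `R`, weighted by
`x^{-e} (p-x)^{-t}` and by the sum of the `∏ a_i^{-F_i-1}` with `∑ a_i = p q + x`. -/
abbrev ChainState : Type := List ℕ × (ℕ × List ℕ) × Option (ℕ × ℕ × List ℕ)

/-- The value of a state with a marked variable. -/
noncomputable def markedVal (L : List ℕ) (q : ℕ) (F : List ℕ) (e t : ℕ) (R : List ℕ) (p : ℕ) : ℚ :=
  chain L (fun x => ((x : ℚ) ^ e)⁻¹ * (((p : ℚ) - x) ^ t)⁻¹ * chain R delta x *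
    unitSum p F (p * q + x)) p

/-- The value of a state. -/
noncomputable def stateVal (s : ChainState) (p : ℕ) : ℚ :=
  match s.2.2 with
  | none => chain s.1 delta p * unitSum p s.2.1.2 (p * s.2.1.1)
  | some o => markedVal s.1 s.2.1.1 s.2.1.2 o.1 o.2.1 o.2.2 p

/-- The states that arise when an exponent is lowered and the marked variable moves on. -/
def moves (L : List ℕ) (q e : ℕ) (R : List ℕ) (i : Bool × List ℕ) : List ChainState :=
  if i.1 then
    ((L ++ e :: R, (q, i.2), none) ::
      (insertions R).map fun y => (L ++ e :: y.1, (q, i.2), some (y.2.1, 0, y.2.2))) ++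
    (if q = 0 then [] else
      (insertions L).map fun y => (y.1, (q - 1, i.2), some (y.2.1, 0, y.2.2 ++ e :: R)))
  else [(L, (q, i.2), some (e + 1, 0, R))]

/-- A step from a state without marked variable. -/
def plainStep (L : List ℕ) (q : ℕ) (F : List ℕ) : List ChainState :=
  List.casesOn F [(L, (q, F), none)] fun s F' => if q = 0 then [] else
    (insertions L).map fun y => (y.1, (q - 1, F'), some (y.2.1, s + 1, y.2.2))

/-- A step from a state with a marked variable. -/
def markedStep (L : List ℕ) (q : ℕ) (F : List ℕ) (o : ℕ × ℕ × List ℕ) (j : ℕ) :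
    List (Coef × ChainState) :=
  if o.2.1 = 0 then
    ((lowerings F).flatMap (moves L q (o.1 + j) o.2.2)).map fun s => (((-(q : ℤ)) ^ j, 1), s)
  else [((-1, 1), (L, (q, F), some (o.1 + j + 1, o.2.1 - 1, o.2.2)))]

/-- The expansion of the value of a state in terms of those of simpler states; `j` is the exponent
of `p`. -/
def stateStep (s : ChainState) (j : ℕ) : List (Coef × ChainState) :=
  Option.casesOn s.2.2
    (if j = 0 then (plainStep s.1 s.2.1.1 s.2.1.2).map fun x => ((1, 1), x) else [])
    fun o => markedStep s.1 s.2.1.1 s.2.1.2 o j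

theorem chain_delta_mul_sum (R : List ℕ) (h : ℕ → ℚ) (y : ℕ) :
    chain R delta y * ∑ b ∈ Finset.Ioo 0 y, h b =
      ((insertions R).map fun i =>
        chain i.1 (fun b => h b * ((b : ℚ) ^ i.2.1)⁻¹ * chain i.2.2 delta b) y).sum := by
  rw [← chain_mul_sum_Ioo, mul_comm, ← chain_mul_left]
  refine chain_congr R fun x _ => ?_
  unfold delta
  split_ifs with hx
  · rw [hx]; ring
  · ring

theorem stateVal_plainStep (L : List ℕ) (q : ℕ) (F : List ℕ) (p : ℕ) :
    stateVal (L, (q, F), none) p = ((plainStep L q F).map (stateVal · p)).sum := by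
  cases F with
  | nil => simp [plainStep]
  | cons s F =>
    cases q with
    | zero => simp [plainStep, stateVal, unitSum_cons_zero]
    | succ q =>
      simp only [plainStep, stateVal, unitSum_cons_of_dvd, chain_delta_mul_sum, List.map_map,
        Nat.succ_ne_zero, if_false, Nat.add_sub_cancel]
      congr 1
      refine List.map_congr_left fun i _ => ?_
      simp only [Function.comp_apply, markedVal]
      exact chain_congr _ fun x _ => by ring

/-- After an exponent has vanished, x joins the chain between L and R. The new remainder b is
inserted into R if b < x and into L if b > x. -/
theorem sum_moves (L : List ℕ) (q e : ℕ) (R : List ℕ) (i : Bool × List ℕ) (p : ℕ) :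
    ((moves L q e R i).map (stateVal · p)).sum =
      chain L (fun x => ((x : ℚ) ^ (e + 1))⁻¹ * chain R delta x *
        (if i.1 then ∑ b ∈ Finset.range x, unitSum p i.2 (p * q + b) +
            (if q = 0 then 0 else ∑ b ∈ Finset.Ioo x p, unitSum p i.2 (p * (q - 1) + b))
          else unitSum p i.2 (p * q + x))) p := by
  obtain ⟨_ | _, F⟩ := i
  · simp [moves, stateVal, markedVal]
  · simp only [moves, if_true]
    have h1 : ∀ x < p, ((x : ℚ) ^ (e + 1))⁻¹ * chain R delta x *
        (∑ b ∈ Finset.range x, unitSum p F (p * q + b) +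
          (if q = 0 then 0 else ∑ b ∈ Finset.Ioo x p, unitSum p F (p * (q - 1) + b))) =
        unitSum p F (p * q) * (((x : ℚ) ^ (e + 1))⁻¹ * chain R delta x) +
        ((x : ℚ) ^ (e + 1))⁻¹ *
          (chain R delta x * ∑ b ∈ Finset.Ioo 0 x, unitSum p F (p * q + b)) +
        (((x : ℚ) ^ (e + 1))⁻¹ * chain R delta x) * (if q = 0 then 0 else
          ∑ b ∈ Finset.Ioo x p, unitSum p F (p * (q - 1) + b)) := by
      intro x _
      rcases Nat.eq_zero_or_pos x with rfl | hx
      · simp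
      -- The value b = 0 is split off: there the total is the multiple p q of p, and the state has
      -- no marked variable.
      · have e : Finset.range x = insert 0 (Finset.Ioo 0 x) := by
          ext b; simp only [Finset.mem_range, Finset.mem_insert, Finset.mem_Ioo]; omega
        rw [e, Finset.sum_insert (by simp)]
        simp only [add_zero]
        ring
    rw [chain_congr L h1, chain_add, chain_add, chain_mul_left, List.map_append, List.sum_append,
      List.map_cons, List.sum_cons]
    congr 1
    · congr 1
      · simp only [stateVal]
        rw [chain_append, mul_comm]
      · simp only [chain_delta_mul_sum, ← List.sum_map_mul_left]
        rw [chain_list_sum, List.map_map]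
        congr 1
        refine List.map_congr_left fun y _ => ?_
        simp only [Function.comp_apply, stateVal, markedVal, pow_zero, inv_one, mul_one]
        rw [chain_append]
        refine chain_congr L fun x _ => ?_
        congr 1
        exact chain_congr _ fun b _ => by ring
    · by_cases hq : q = 0
      · simp [hq, chain_zero_right]
      · simp only [hq, if_false]
        rw [chain_mul_sum_Ioo, List.map_map]
        congr 1
        refine List.map_congr_left fun y _ => ?_
        simp only [Function.comp_apply, stateVal, markedVal, pow_zero, inv_one, mul_one]
        refine chain_congr _ fun x _ => ?_
        rw [chain_append]
        ring

theorem sum_moves_lowerings (L : List ℕ) (q e : ℕ) (R F : List ℕ) (p : ℕ) :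
    (((lowerings F).flatMap (moves L q e R)).map (stateVal · p)).sum =
      chain L (fun x => ((x : ℚ) ^ (e + 1))⁻¹ * chain R delta x *
        (((p : ℚ) * q + x) * unitSum p F (p * q + x))) p := by
  rw [List.map_flatMap, sum_flatMap]
  simp only [sum_moves]
  rw [← chain_list_sum]
  refine chain_congr L fun x hx => ?_
  rw [List.sum_map_mul_left, mul_unitSum hx]

/-! ### Validity and termination of the reduction steps -/

theorem small_chain_delta {p x : ℕ} (hp : p.Prime) (hx : x ≤ p) (R : List ℕ) :
    Small p 0 (chain R delta x) := by
  refine chain_small hp hx R fun z _ => ?_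
  unfold delta
  split_ifs
  · exact Small.one p
  · exact Small.zero_right p 0

/-- If t = 0, insert (p q + x)/(p q + x): the numerator lowers an exponent by `mul_unitSum`, the
denominator is expanded around x. If t > 0, one factor 1/(p - x) is expanded as -∑ p^j / x^(j+1).
The remainders are divisible by p^n because x and p - x are units for 0 < x < p. -/
theorem small_stateVal_some {p : ℕ} (hp : p.Prime) (n : ℕ) (L : List ℕ) (q : ℕ) (F : List ℕ)
    (o : ℕ × ℕ × List ℕ) :
    Small p n (markedVal L q F o.1 o.2.1 o.2.2 p -
      ∑ j ∈ Finset.range n, (p : ℚ) ^ j * lsum (markedStep L q F o j) (stateVal · p)) := by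
  obtain ⟨e, t, R⟩ := o
  cases t with
  | zero =>
    simp only [markedStep, if_true, lsum_map_pair, sum_moves_lowerings, cval_int, markedVal,
      pow_zero, inv_one, mul_one]
    have h1 : ∀ j : ℕ, ∀ f : ℕ → ℚ, (p : ℚ) ^ j * (((-(q : ℤ)) ^ j : ℤ) * chain L f p) =
        chain L (fun x => (-((p : ℚ) * q)) ^ j * f x) p := by
      intro j f
      rw [chain_mul_left, neg_mul_eq_mul_neg, mul_pow, mul_assoc]; push_cast; rfl
    simp only [h1]
    rw [← chain_sum, ← chain_sub]
    refine chain_small hp le_rfl L fun x hx => ?_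
    -- At x = 0 everything vanishes, since `chain R delta 0` is an empty sum.
    rcases Nat.eq_zero_or_pos x with rfl | h0
    · simpa using Small.zero_right p n
    have hx0 : (x : ℚ) ≠ 0 := by positivity
    have hu : (x : ℚ) + p * q ≠ 0 := by positivity
    have h2 := inv_sub_geom_sum hx0 hu n
    have h3 : ((x : ℚ) ^ e)⁻¹ * chain R delta x * unitSum p F (p * q + x) -
        ∑ j ∈ Finset.range n, (-((p : ℚ) * q)) ^ j * (((x : ℚ) ^ (e + j + 1))⁻¹ * chain R delta x *
          (((p : ℚ) * q + x) * unitSum p F (p * q + x))) =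
        ((x : ℚ) ^ e)⁻¹ * chain R delta x * unitSum p F (p * q + x) *
          ((-((p : ℚ) * q)) ^ n * ((x : ℚ) ^ n)⁻¹) := by
      have h4 : ∀ j, (-((p : ℚ) * q)) ^ j * (((x : ℚ) ^ (e + j + 1))⁻¹ * chain R delta x *
          (((p : ℚ) * q + x) * unitSum p F (p * q + x))) =
          (((x : ℚ) ^ e)⁻¹ * chain R delta x * unitSum p F (p * q + x) * (x + p * q)) *
            ((-((p : ℚ) * q)) ^ j * ((x : ℚ) ^ (j + 1))⁻¹) := by
        intro j
        rw [add_assoc, pow_add, mul_inv]; ring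
      simp only [h4]
      rw [← Finset.mul_sum, ← sub_sub_cancel ((x : ℚ) + p * q)⁻¹ (∑ j ∈ Finset.range n, _), h2]
      field_simp
      ring
    rw [h3]
    have h5 : Small p n ((-((p : ℚ) * q)) ^ n * ((x : ℚ) ^ n)⁻¹) := by
      rw [neg_mul_eq_mul_neg, mul_pow, ← inv_pow]
      have := ((Small.self_pow p n).mul_right ((Small.natCast p q).neg.pow n)).mul_right
        ((Small.inv_lt hp h0 hx).pow n)
      exact this
    refine Small.mul_left ?_ h5
    refine ((?_ : Small p 0 _).mul_left (small_chain_delta hp hx.le R)).mul_left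
      (small_unitSum hp F _)
    rw [← inv_pow]; exact (Small.inv_lt hp h0 hx).pow e
  | succ t =>
    simp only [markedStep, Nat.succ_ne_zero, if_false, lsum_cons, lsum_nil, add_zero, cval_int,
      stateVal, markedVal, Nat.add_sub_cancel, Int.cast_neg, Int.cast_one]
    have h1 : ∀ j : ℕ, ∀ f : ℕ → ℚ, (p : ℚ) ^ j * (-1 * chain L f p) =
        chain L (fun x => (p : ℚ) ^ j * (-1 * f x)) p := by
      intro j f
      rw [chain_mul_left, chain_mul_left]
    simp only [h1]
    rw [← chain_sum, ← chain_sub]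
    refine chain_small hp le_rfl L fun x hx => ?_
    rcases Nat.eq_zero_or_pos x with rfl | h0
    · simpa using Small.zero_right p n
    have hx0 : (x : ℚ) ≠ 0 := by positivity
    have hpx : ((p - x : ℕ) : ℚ) = (p : ℚ) - x := Nat.cast_sub hx.le
    have hpx0 : (p : ℚ) - x ≠ 0 := by
      rw [← hpx]; exact_mod_cast (by omega : p - x ≠ 0)
    have hu : (x : ℚ) + -(p : ℚ) ≠ 0 := by
      rw [← sub_eq_add_neg, ← neg_sub]; exact neg_ne_zero.2 hpx0
    have h2 := inv_sub_geom_sum hx0 hu n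
    rw [neg_neg, ← sub_eq_add_neg, ← neg_sub (p : ℚ) x, inv_neg] at h2
    have h3 : ((x : ℚ) ^ e)⁻¹ * (((p : ℚ) - x) ^ (t + 1))⁻¹ * chain R delta x *
          unitSum p F (p * q + x) -
        ∑ j ∈ Finset.range n, (p : ℚ) ^ j * (-1 * (((x : ℚ) ^ (e + j + 1))⁻¹ *
          (((p : ℚ) - x) ^ t)⁻¹ * chain R delta x * unitSum p F (p * q + x))) =
        (p : ℚ) ^ n * (((x : ℚ) ^ n)⁻¹ * (((p : ℚ) - x)⁻¹ * (((x : ℚ) ^ e)⁻¹ *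
          ((((p : ℚ) - x) ^ t)⁻¹ * (chain R delta x * unitSum p F (p * q + x)))))) := by
      have h4 : ∀ j, (p : ℚ) ^ j * (-1 * (((x : ℚ) ^ (e + j + 1))⁻¹ *
          (((p : ℚ) - x) ^ t)⁻¹ * chain R delta x * unitSum p F (p * q + x))) =
          -(((x : ℚ) ^ e)⁻¹ * (((p : ℚ) - x) ^ t)⁻¹ * chain R delta x * unitSum p F (p * q + x)) *
            ((p : ℚ) ^ j * ((x : ℚ) ^ (j + 1))⁻¹) := by
        intro j
        rw [add_assoc, pow_add, mul_inv]; ring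
      simp only [h4]
      rw [← Finset.mul_sum]
      have h6 : ∑ j ∈ Finset.range n, (p : ℚ) ^ j * ((x : ℚ) ^ (j + 1))⁻¹ =
          -((p : ℚ) - x)⁻¹ - (p : ℚ) ^ n * ((x : ℚ) ^ n)⁻¹ * -((p : ℚ) - x)⁻¹ := by
        rw [← h2]; ring
      rw [h6, pow_succ, mul_inv]
      ring
    rw [h3]
    refine (Small.self_pow p n).mul_right ?_
    have h7 : Small p 0 (((p : ℚ) - x)⁻¹) := by
      rw [← hpx]; exact Small.inv_lt hp (by omega) (by omega)
    rw [← inv_pow, ← inv_pow, ← inv_pow]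
    exact ((Small.inv_lt hp h0 hx).pow n).mul_left (h7.mul_left
      (((Small.inv_lt hp h0 hx).pow e).mul_left ((h7.pow t).mul_left
        ((small_chain_delta hp hx.le R).mul_left (small_unitSum hp F _)))))

theorem small_stateVal {p : ℕ} (hp : p.Prime) {n : ℕ} (hn : 0 < n) (s : ChainState) :
    Small p n (stateVal s p -
      ∑ j ∈ Finset.range n, (p : ℚ) ^ j * lsum (stateStep s j) (stateVal · p)) := by
  obtain ⟨L, ⟨q, F⟩, _ | o⟩ := s
  · simp only [stateStep]
    rw [sum_range_level_zero hn, lsum_map_pair, stateVal_plainStep, cval_one, one_mul, sub_self]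
    exact Small.zero_right p n
  · exact small_stateVal_some hp n L q F o

/-- A bound for the number of steps after which a state is fully expanded. -/
def stateMeasure (s : ChainState) : ℕ :=
  (s.2.1.2.map fun f => f + 3).sum + Option.casesOn s.2.2 0 fun o => o.2.1 + 1

theorem sum_of_mem_lowerings {F : List ℕ} {i : Bool × List ℕ} (hi : i ∈ lowerings F) :
    (i.2.map fun f => f + 3).sum + (if i.1 then 3 else 1) ≤ (F.map fun f => f + 3).sum := by
  induction F generalizing i with
  | nil => simp [lowerings] at hi
  | cons s F ih =>
    rw [lowerings, List.mem_cons, List.mem_map] at hi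
    rcases hi with rfl | ⟨x, hx, rfl⟩
    · split_ifs with h0 <;> simp_all <;> omega
    · have := ih hx
      simp only [List.map_cons, List.sum_cons]
      omega

theorem stateMeasure_of_mem_moves {L R F : List ℕ} {q e : ℕ} {i : Bool × List ℕ}
    (hi : i ∈ lowerings F) {s : ChainState} (hs : s ∈ moves L q e R i) :
    stateMeasure s ≤ (F.map fun f => f + 3).sum := by
  have h := sum_of_mem_lowerings hi
  unfold moves at hs
  split_ifs at hs h with h1 h2
  · simp only [List.append_nil, List.mem_cons, List.mem_map] at hs
    rcases hs with rfl | ⟨y, _, rfl⟩ <;> simp only [stateMeasure] <;> omega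
  · simp only [List.mem_append, List.mem_cons, List.mem_map] at hs
    rcases hs with (rfl | ⟨y, _, rfl⟩) | ⟨y, _, rfl⟩ <;> simp only [stateMeasure] <;> omega
  · rw [List.mem_singleton] at hs
    subst hs
    simp only [stateMeasure]
    omega

/-- The weight f + 3 of an exponent is what termination needs: marking a variable trades f + 3 for t
+ 1 with t = f + 1, and expanding 1/(p - x) lowers t. Lowering an exponent costs at least 1 while
the mark is renewed with t = 0. -/
theorem stateMeasure_of_mem_stateStep {k : ℕ} {s : ChainState} (h : stateMeasure s ≤ k + 1)
    {j : ℕ} {x : Coef × ChainState} (hx : x ∈ stateStep s j) : stateMeasure x.2 ≤ k := by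
  obtain ⟨L, ⟨q, F⟩, _ | ⟨e, t, R⟩⟩ := s
  · simp only [stateStep] at hx
    split_ifs at hx with h0
    · obtain ⟨s, hs, rfl⟩ := List.mem_map.1 hx
      cases F with
      | nil =>
        simp only [plainStep, List.mem_singleton] at hs
        subst hs
        simp [stateMeasure]
      | cons f F =>
        simp only [plainStep] at hs
        split_ifs at hs with hq
        · simp at hs
        · obtain ⟨y, _, rfl⟩ := List.mem_map.1 hs
          simp only [stateMeasure, List.map_cons, List.sum_cons] at h ⊢
          omega
    · simp at hx
  · simp only [stateStep, markedStep] at hx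
    split_ifs at hx with h0
    · obtain ⟨s, hs, rfl⟩ := List.mem_map.1 hx
      obtain ⟨i, hi, hs⟩ := List.mem_flatMap.1 hs
      have := stateMeasure_of_mem_moves hi hs
      simp only [stateMeasure] at h this ⊢
      omega
    · rw [List.mem_singleton] at hx
      subst hx
      simp only [stateMeasure] at h ⊢
      omega

/-- The harmonic word of a fully expanded state, if its value is not zero. -/
def finalWord (s : ChainState) : List (Coef × List ℕ) :=
  if s.2.1 = (0, []) then Option.casesOn s.2.2 [((1, 1), s.1)] fun _ => [] else []

/-- The value of a fully expanded state. -/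
def finalVal (s : ChainState) (p : ℕ) : ℚ := lsum (finalWord s) (harmonicVal · p)

/-- At measure 0 no variables and no mark are left. The empty sum of variables equals p q only for q
= 0. -/
theorem finalVal_eq {s : ChainState} (hs : stateMeasure s ≤ 0) {p : ℕ} (hp : 0 < p) :
    finalVal s p = stateVal s p := by
  obtain ⟨L, ⟨q, F⟩, _ | ⟨e, t, R⟩⟩ := s
  · cases F with
    | cons f F => simp [stateMeasure] at hs
    | nil =>
      simp only [finalVal, finalWord, stateVal, unitSum, unitProd_nil, PowerSeries.coeff_one]
      by_cases hq : q = 0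
      · simp [hq, harmonicVal_eq_chain L hp]
      · simp [hq, hp.ne']
  · simp [stateMeasure] at hs

/-! ### Primitive recursiveness of the reduction -/

theorem primrec_insertions : Primrec insertions := by
  have h : Primrec fun L : List ℕ => (List.rec [([], 0, [])] (fun s t ih =>
      ([], 0, s :: t) :: ([], s + 1, t) :: ih.map fun x => (s :: x.1, x.2.1, x.2.2)) L :
        List (List ℕ × ℕ × List ℕ)) := by
    refine Primrec.list_rec Primrec.id (Primrec.const _) (h := fun _ y =>
      ([], 0, y.1 :: y.2.1) :: ([], y.1 + 1, y.2.1) ::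
        y.2.2.map fun x => (y.1 :: x.1, x.2.1, x.2.2)) ?_
    have s := Primrec.fst.comp (Primrec.snd (α := List ℕ)
      (β := ℕ × List ℕ × List (List ℕ × ℕ × List ℕ)))
    have t := Primrec.fst.comp (Primrec.snd.comp (Primrec.snd (α := List ℕ)
      (β := ℕ × List ℕ × List (List ℕ × ℕ × List ℕ))))
    refine Primrec.list_cons.comp (Primrec.pair (Primrec.const _) (Primrec.pair (Primrec.const _)
      (Primrec.list_cons.comp s t))) (Primrec.list_cons.comp (Primrec.pair (Primrec.const _)
        (Primrec.pair (Primrec.succ.comp s) t)) (Primrec.list_map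
          (Primrec.snd.comp (Primrec.snd.comp Primrec.snd)) ?_))
    exact Primrec.pair (Primrec.list_cons.comp (s.comp Primrec.fst)
      (Primrec.fst.comp Primrec.snd)) (Primrec.snd.comp Primrec.snd)
  refine h.of_eq fun L => ?_
  induction L with
  | nil => rfl
  | cons s t ih => rw [insertions, ← ih]

theorem primrec_lowerings : Primrec lowerings := by
  have h : Primrec fun L : List ℕ => (List.rec [] (fun s t ih =>
      (if s = 0 then (true, t) else (false, (s - 1) :: t)) ::
        ih.map fun x => (x.1, s :: x.2)) L : List (Bool × List ℕ)) := by
    refine Primrec.list_rec Primrec.id (Primrec.const _) (h := fun _ y =>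
      (if y.1 = 0 then (true, y.2.1) else (false, (y.1 - 1) :: y.2.1)) ::
        y.2.2.map fun x => (x.1, y.1 :: x.2)) ?_
    have s := Primrec.fst.comp (Primrec.snd (α := List ℕ)
      (β := ℕ × List ℕ × List (Bool × List ℕ)))
    have t := Primrec.fst.comp (Primrec.snd.comp (Primrec.snd (α := List ℕ)
      (β := ℕ × List ℕ × List (Bool × List ℕ))))
    refine Primrec.list_cons.comp (Primrec.ite (Primrec.eq.comp s (Primrec.const 0))
      (Primrec.pair (Primrec.const _) t) (Primrec.pair (Primrec.const _)
        (Primrec.list_cons.comp (Primrec.pred.comp s) t))) (Primrec.list_map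
          (Primrec.snd.comp (Primrec.snd.comp Primrec.snd)) ?_)
    exact Primrec.pair (Primrec.fst.comp Primrec.snd) (Primrec.list_cons.comp (s.comp Primrec.fst)
      (Primrec.snd.comp Primrec.snd))
  refine h.of_eq fun L => ?_
  induction L with
  | nil => rfl
  | cons s t ih => rw [lowerings, ← ih]

theorem primrec_moves {α : Type*} [Primcodable α] {L R : α → List ℕ} {q e : α → ℕ}
    {i : α → Bool × List ℕ} (hL : Primrec L) (hR : Primrec R) (hq : Primrec q) (he : Primrec e)
    (hi : Primrec i) : Primrec fun a => moves (L a) (q a) (e a) (R a) (i a) := by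
  have hF := Primrec.snd.comp hi
  have hs := Primrec.option_some (α := ℕ × ℕ × List ℕ)
  refine Primrec.ite (Primrec.eq.comp (Primrec.fst.comp hi) (Primrec.const true)) ?_ ?_
  · refine Primrec.list_append.comp (Primrec.list_cons.comp (Primrec.pair
      (Primrec.list_append.comp hL (Primrec.list_cons.comp he hR))
      (Primrec.pair (Primrec.pair hq hF) (Primrec.const none))) (Primrec.list_map
        (primrec_insertions.comp hR) ?_)) (Primrec.ite (Primrec.eq.comp hq (Primrec.const 0))
          (Primrec.const []) (Primrec.list_map (primrec_insertions.comp hL) ?_))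
    · exact Primrec.pair (Primrec.list_append.comp (hL.comp Primrec.fst)
        (Primrec.list_cons.comp (he.comp Primrec.fst) (Primrec.fst.comp Primrec.snd)))
        (Primrec.pair (Primrec.pair (hq.comp Primrec.fst) (hF.comp Primrec.fst))
          (hs.comp (Primrec.pair (Primrec.fst.comp (Primrec.snd.comp Primrec.snd))
            (Primrec.pair (Primrec.const 0) (Primrec.snd.comp (Primrec.snd.comp Primrec.snd))))))
    · exact Primrec.pair (Primrec.fst.comp Primrec.snd)
        (Primrec.pair (Primrec.pair (Primrec.pred.comp (hq.comp Primrec.fst))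
          (hF.comp Primrec.fst))
          (hs.comp (Primrec.pair (Primrec.fst.comp (Primrec.snd.comp Primrec.snd))
            (Primrec.pair (Primrec.const 0) (Primrec.list_append.comp
              (Primrec.snd.comp (Primrec.snd.comp Primrec.snd)) (Primrec.list_cons.comp
                (he.comp Primrec.fst) (hR.comp Primrec.fst)))))))
  · exact Primrec.list_cons.comp (Primrec.pair hL (Primrec.pair (Primrec.pair hq hF)
      (hs.comp (Primrec.pair (Primrec.succ.comp he) (Primrec.pair (Primrec.const 0) hR)))))
      (Primrec.const [])

theorem primrec_plainStep {α : Type*} [Primcodable α] {L F : α → List ℕ} {q : α → ℕ}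
    (hL : Primrec L) (hq : Primrec q) (hF : Primrec F) :
    Primrec fun a => plainStep (L a) (q a) (F a) := by
  refine Primrec.list_casesOn hF (h := fun a y => if q a = 0 then [] else
    (insertions (L a)).map fun z => (z.1, (q a - 1, y.2), some (z.2.1, y.1 + 1, z.2.2)))
    (Primrec.list_cons.comp (Primrec.pair hL (Primrec.pair (Primrec.pair hq hF)
      (Primrec.const none))) (Primrec.const [])) ?_
  refine Primrec.ite (Primrec.eq.comp (hq.comp Primrec.fst) (Primrec.const 0)) (Primrec.const [])
    (Primrec.list_map (primrec_insertions.comp (hL.comp Primrec.fst)) ?_)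
  exact Primrec.pair (Primrec.fst.comp Primrec.snd) (Primrec.pair (Primrec.pair
    (Primrec.pred.comp (hq.comp (Primrec.fst.comp Primrec.fst)))
    (Primrec.snd.comp (Primrec.snd.comp Primrec.fst))) (Primrec.option_some.comp
      (Primrec.pair (Primrec.fst.comp (Primrec.snd.comp Primrec.snd)) (Primrec.pair
        (Primrec.succ.comp (Primrec.fst.comp (Primrec.snd.comp Primrec.fst)))
        (Primrec.snd.comp (Primrec.snd.comp Primrec.snd))))))

theorem primrec_markedStep {α : Type*} [Primcodable α] {L F : α → List ℕ} {q j : α → ℕ}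
    {o : α → ℕ × ℕ × List ℕ} (hL : Primrec L) (hq : Primrec q) (hF : Primrec F) (ho : Primrec o)
    (hj : Primrec j) : Primrec fun a => markedStep (L a) (q a) (F a) (o a) (j a) := by
  have he := Primrec.fst.comp ho
  have ht := Primrec.fst.comp (Primrec.snd.comp ho)
  have hR := Primrec.snd.comp (Primrec.snd.comp ho)
  refine Primrec.ite (Primrec.eq.comp ht (Primrec.const 0)) (Primrec.list_map
    (Primrec.list_flatMap (primrec_lowerings.comp hF) (primrec_moves (hL.comp Primrec.fst)
      (hR.comp Primrec.fst) (hq.comp Primrec.fst)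
      ((Primrec.nat_add.comp he hj).comp Primrec.fst) Primrec.snd)) ?_) ?_
  · exact Primrec.pair (Primrec.pair (primrec_int_pow.comp (primrec_int_neg.comp
      (primrec_int_natCast.comp (hq.comp Primrec.fst))) (hj.comp Primrec.fst)) (Primrec.const 1))
      Primrec.snd
  · exact Primrec.list_cons.comp (Primrec.pair (Primrec.const _) (Primrec.pair hL (Primrec.pair
      (Primrec.pair hq hF) (Primrec.option_some.comp (Primrec.pair (Primrec.succ.comp
        (Primrec.nat_add.comp he hj)) (Primrec.pair (Primrec.pred.comp ht) hR))))))
      (Primrec.const [])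

theorem primrec_stateStep : Primrec₂ stateStep := by
  have hL := Primrec.fst.comp (Primrec.fst (α := ChainState) (β := ℕ))
  have hq := Primrec.fst.comp (Primrec.fst.comp (Primrec.snd.comp
    (Primrec.fst (α := ChainState) (β := ℕ))))
  have hF := Primrec.snd.comp (Primrec.fst.comp (Primrec.snd.comp
    (Primrec.fst (α := ChainState) (β := ℕ))))
  have ho := Primrec.snd.comp (Primrec.snd.comp (Primrec.fst (α := ChainState) (β := ℕ)))
  refine Primrec.option_casesOn ho (Primrec.ite (Primrec.eq.comp Primrec.snd (Primrec.const 0))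
    (Primrec.list_map (primrec_plainStep hL hq hF)
      (Primrec.pair (Primrec.const _) Primrec.snd)) (Primrec.const [])) ?_
  exact primrec_markedStep (hL.comp Primrec.fst) (hq.comp Primrec.fst) (hF.comp Primrec.fst)
    Primrec.snd (Primrec.snd.comp Primrec.fst)

theorem primrec_list_sum : Primrec (List.sum : List ℕ → ℕ) :=
  (Primrec.list_foldr Primrec.id (Primrec.const 0)
    (Primrec.nat_add.comp (Primrec.fst.comp Primrec.snd) (Primrec.snd.comp Primrec.snd)).to₂).of_eq
    fun _ => rfl

theorem primrec_stateMeasure : Primrec stateMeasure := by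
  refine Primrec.nat_add.comp (primrec_list_sum.comp (Primrec.list_map
    (Primrec.snd.comp (Primrec.fst.comp Primrec.snd))
    (Primrec.nat_add.comp Primrec.snd (Primrec.const 3)).to₂)) ?_
  exact Primrec.option_casesOn (Primrec.snd.comp Primrec.snd) (Primrec.const 0)
    (Primrec.succ.comp (Primrec.fst.comp (Primrec.snd.comp Primrec.snd)))

theorem primrec_finalWord : Primrec finalWord := by
  refine Primrec.ite (Primrec.eq.comp (Primrec.fst.comp Primrec.snd) (Primrec.const _))
    (Primrec.option_casesOn (Primrec.snd.comp Primrec.snd) (Primrec.list_cons.comp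
      (Primrec.pair (Primrec.const _) Primrec.fst) (Primrec.const [])) (Primrec.const []).to₂)
    (Primrec.const [])

theorem Expands.of_exact {α β : Type*} [Primcodable α] [Primcodable β] {v : α → ℕ → ℚ}
    {w : β → ℕ → ℚ} {T : α → List (Coef × β)} (hT : Primrec T)
    (h : ∀ a, ∀ᶠ p : ℕ in atTop, p.Prime → v a p = lsum (T a) (w · p)) : Expands v w := by
  refine ⟨fun a j => if j = 0 then T a else [], Primrec.ite (Primrec.eq.comp Primrec.snd
    (Primrec.const 0)) (hT.comp Primrec.fst) (Primrec.const []), fun a n hn => ?_⟩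
  filter_upwards [h a] with p hp hpp
  rw [sum_range_level_zero hn, hp hpp, sub_self]
  exact Small.zero_right p n

theorem expands_stateVal : Expands stateVal harmonicVal := by
  have h1 : Expands stateVal finalVal := by
    refine Expands.iterate (fun _ => stateStep)
      (primrec_stateStep.comp (Primrec.fst.comp Primrec.snd) (Primrec.snd.comp Primrec.snd))
      (fun k => Nat.casesOn k finalVal fun _ => stateVal) (fun k s => stateMeasure s ≤ k)
      (fun k s h j x hx => stateMeasure_of_mem_stateStep h hx) (fun k s h n hn => ?_)
      (g := fun s => (stateMeasure s + 1, s))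
      -- One step more than the measure, so that the starting value is `stateVal` by definition and
      -- `finalVal` is used only at level 0.
      (Primrec.pair (Primrec.succ.comp primrec_stateMeasure) Primrec.id) (fun s => Nat.le_succ _)
    refine Eventually.of_forall fun p hp => ?_
    have := small_stateVal hp hn s
    cases k with
    | zero =>
      convert this using 4
      exact lsum_congr _ fun x hx => finalVal_eq (stateMeasure_of_mem_stateStep h hx) hp.pos
    | succ k => exact this
  exact h1.trans (Expands.of_exact primrec_finalWord fun s => Eventually.of_forall fun p _ => rfl)

/-! ### The curious sums as coefficients of a power series -/

/-- `∑ X ^ n / n` over the `n` that are not divisible by `p`. -/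
noncomputable def coprimeSeries (p : ℕ) : ℚ⟦X⟧ :=
  PowerSeries.mk fun n => if p ∣ n then 0 else (n : ℚ)⁻¹

theorem integral_coprimeSeries {p : ℕ} (hp : p.Prime) : IntegralSeries p (coprimeSeries p) := by
  intro n
  rw [coprimeSeries, coeff_mk]
  split_ifs with h
  · exact Small.zero_right p 0
  · exact Small.inv_natCast hp h

theorem sum_antidiagonalTuple_succ (k N : ℕ) (f : (Fin (k + 1) → ℕ) → ℚ) :
    ∑ x ∈ Finset.Nat.antidiagonalTuple (k + 1) N, f x =
      ∑ i ∈ Finset.HasAntidiagonal.antidiagonal N,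
        ∑ x ∈ Finset.Nat.antidiagonalTuple k i.2, f (Fin.cons i.1 x) := by
  change ((List.Nat.antidiagonalTuple (k + 1) N).map f).sum =
    ((List.Nat.antidiagonal N).map fun i =>
      ((List.Nat.antidiagonalTuple k i.2).map fun x => f (Fin.cons i.1 x)).sum).sum
  rw [List.Nat.antidiagonalTuple, List.map_flatMap, sum_flatMap]
  simp only [List.map_map]
  rfl

theorem coeff_pow_eq_sum_antidiagonalTuple (φ : ℚ⟦X⟧) (k N : ℕ) :
    coeff N (φ ^ k) = ∑ x ∈ Finset.Nat.antidiagonalTuple k N, ∏ i, coeff (x i) φ := by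
  induction k generalizing N with
  | zero =>
    cases N with
    | zero => simp
    | succ N => simp [coeff_one]
  | succ k ih =>
    rw [pow_succ', coeff_mul, sum_antidiagonalTuple_succ]
    refine Finset.sum_congr rfl fun i _ => ?_
    rw [ih, Finset.mul_sum]
    exact Finset.sum_congr rfl fun x _ => by rw [Fin.prod_univ_succ]; simp

/-- Both side conditions are built into the series: its coefficients vanish at the multiples of p,
and 0 is one of them. -/
theorem curiousSum_eq_coeff {p : ℕ} (hp : p.Prime) (r k : ℕ) :
    curiousSum r k p = coeff (p ^ r) (coprimeSeries p ^ k) := by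
  rw [coeff_pow_eq_sum_antidiagonalTuple, curiousSum, Finset.sum_filter]
  refine Finset.sum_congr rfl fun f _ => ?_
  simp only [coprimeSeries, coeff_mk]
  split_ifs with h
  · rw [one_div, ← Finset.prod_inv_distrib]
    refine Finset.prod_congr rfl fun i _ => ?_
    rw [if_neg fun hd => h.2 (hd.trans (Finset.dvd_prod_of_mem f (Finset.mem_univ i)))]
  · have h1 : ∃ i, p ∣ f i := by
      by_contra hc
      push Not at hc
      refine h ⟨fun i => Nat.pos_of_ne_zero fun h0 => hc i (h0 ▸ dvd_zero p), fun hd => ?_⟩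
      obtain ⟨i, _, hi⟩ := (Prime.dvd_finsetProd_iff hp.prime f).1 hd
      exact hc i hi
    obtain ⟨i, hi⟩ := h1
    exact (Finset.prod_eq_zero (f := fun i => if p ∣ f i then (0 : ℚ) else (f i : ℚ)⁻¹)
      (Finset.mem_univ i) (if_pos hi)).symm

/-- The series `f(X ^ p)`. -/
noncomputable def dilate (p : ℕ) (f : ℚ⟦X⟧) : ℚ⟦X⟧ :=
  PowerSeries.mk fun n => if p ∣ n then coeff (n / p) f else 0

theorem dilate_eq_expand {p : ℕ} (hp : p ≠ 0) (f : ℚ⟦X⟧) : dilate p f = expand p hp f := by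
  ext n
  rw [dilate, coeff_mk, coeff_expand]

theorem dilate_mul {p : ℕ} (hp : p ≠ 0) (f g : ℚ⟦X⟧) :
    dilate p (f * g) = dilate p f * dilate p g := by
  simp only [dilate_eq_expand hp, map_mul]

/-- `X ^ f / (1 - X) ^ (f + m)`. -/
noncomputable def binSeries (f m : ℕ) : ℚ⟦X⟧ := X ^ f * (PowerSeries.mk 1) ^ (f + m)

theorem binSeries_mul (f g m n : ℕ) :
    binSeries f m * binSeries g n = binSeries (f + g) (m + n) := by
  unfold binSeries
  ring

theorem coeff_binSeries (f m N : ℕ) :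
    coeff N (binSeries f (m + 1)) = ((N + m).choose (f + m) : ℚ) := by
  rw [binSeries, coeff_X_pow_mul', ← add_assoc, mk_one_pow_eq_mk_choose_add, coeff_mk]
  split_ifs with h
  · congr 2; omega
  · rw [Nat.choose_eq_zero_of_lt (by omega)]; simp

theorem integral_binSeries (p f m : ℕ) : IntegralSeries p (binSeries f m) := by
  refine IntegralSeries.mul ?_ (IntegralSeries.pow ?_ _)
  · intro n
    rw [coeff_X_pow]
    split_ifs
    · exact Small.one p
    · exact Small.zero_right p 0
  · intro n
    simpa using Small.one p

theorem IntegralSeries.dilate {p : ℕ} {f : ℚ⟦X⟧} (hf : IntegralSeries p f) :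
    IntegralSeries p (dilate p f) := by
  intro n
  rw [MHS.dilate, coeff_mk]
  split_ifs
  · exact hf _
  · exact Small.zero_right p 0

/-- Uniqueness of division with remainder: N = a + p q with 0 < a < p has exactly one solution if p
∤ N, and none otherwise. -/
theorem coeff_unitSeries_mul_dilate {p : ℕ} (hp : 0 < p) (s N : ℕ) (g : ℚ⟦X⟧) :
    coeff N (unitSeries p s * dilate p g) =
      if p ∣ N then 0 else (((N % p : ℕ) : ℚ) ^ s)⁻¹ * coeff (N / p) g := by
  rw [coeff_unitSeries_mul]
  have hmod := Nat.mod_lt N hp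
  have key : ∀ i ∈ Finset.range (N + 1), i ≠ N % p →
      (if 0 < i ∧ i < p then ((i : ℚ) ^ s)⁻¹ else 0) * coeff (N - i) (dilate p g) = 0 := by
    intro i hi hne
    split_ifs with h
    · rw [dilate, coeff_mk, if_neg, mul_zero]
      intro hd
      have h1 : i ≡ N [MOD p] := (Nat.modEq_iff_dvd' (by simp at hi; omega)).2 hd
      exact hne (by rw [← h1, Nat.mod_eq_of_lt h.2])
    · rw [zero_mul]
  rw [Finset.sum_eq_single (N % p) key]
  · split_ifs with h1 h2 h2
    · exact absurd (Nat.mod_eq_zero_of_dvd h2) (by omega)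
    · rw [dilate, coeff_mk, if_pos (Nat.dvd_sub_mod N)]
      have := Nat.div_add_mod N p
      have e : N - N % p = p * (N / p) := by omega
      rw [e, Nat.mul_div_cancel_left _ hp]
    · rw [zero_mul]
    · exact absurd (Nat.dvd_of_mod_eq_zero (by omega)) h2
  · intro h
    exact absurd (Finset.mem_range.2 (Nat.lt_succ_of_le (Nat.mod_le N p))) h

/-- Weights `w` and indices `f` such that `q ^ e` is the sum of the `w * q.choose f`. -/
def powerWeights : ℕ → List (ℕ × ℕ)
  | 0 => [(1, 0)]
  | e + 1 => (powerWeights e).flatMap fun y => [(y.1 * (y.2 + 1), y.2 + 1), (y.1 * y.2, y.2)]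

theorem mul_choose_eq (q f : ℕ) :
    (q : ℚ) * q.choose f = (f + 1) * q.choose (f + 1) + f * q.choose f := by
  have h := Nat.choose_succ_right_eq q f
  rcases le_or_gt f q with hf | hf
  · have h' : (q.choose (f + 1) : ℚ) * (f + 1) = q.choose f * (q - f) := by
      rw [← Nat.cast_sub hf]; exact_mod_cast h
    linarith
  · rw [Nat.choose_eq_zero_of_lt hf, Nat.choose_eq_zero_of_lt (by omega)]; simp

theorem sum_powerWeights (q e : ℕ) :
    ((powerWeights e).map fun y => (y.1 : ℚ) * (q.choose y.2 : ℚ)).sum = (q : ℚ) ^ e := by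
  induction e with
  | zero => simp [powerWeights]
  | succ e ih =>
    rw [powerWeights, List.map_flatMap, sum_flatMap, pow_succ', ← ih, ← List.sum_map_mul_left]
    congr 1
    refine List.map_congr_left fun y _ => ?_
    have := mul_choose_eq q y.2
    simp only [List.map_cons, List.map_nil, List.sum_cons, List.sum_nil, add_zero]
    push_cast
    linear_combination -(y.1 : ℚ) * this

/-- The first stage of the expansion: `(r, F, S)` stands for a product of `unitProd S` and a
dilated binomial series, and the coefficient of `X ^ (p * p ^ r)` is taken. -/
def peelStep (_ : ℕ) (s : ℕ × ℕ × List ℕ) (j : ℕ) : List (Coef × (ℕ × ℕ × List ℕ)) :=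
  (powerWeights j).map fun y => (((-1) ^ j * (y.1 : ℤ), 1), (s.1, s.2.1 + y.2, j :: s.2.2))

/-- The sums over `q_i` have been evaluated when all factors have been expanded. -/
noncomputable def peeledVal (s : ℕ × ℕ × List ℕ) (p : ℕ) : ℚ :=
  ∑ c ∈ Finset.range s.2.2.length, unitSum p s.2.2 (p * c) *
    ((p ^ s.1 + (s.2.2.length - 1 - c)).choose (s.2.1 + s.2.2.length - 1) : ℚ)

/-- The coefficient that a state of the first stage stands for, with `k` factors
`coprimeSeries p` left. -/
noncomputable def peelCoeff (k : ℕ) (s : ℕ × ℕ × List ℕ) (p : ℕ) : ℚ :=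
  coeff (p * p ^ s.1) (unitProd p s.2.2 * dilate p (binSeries s.2.1 s.2.2.length) *
    coprimeSeries p ^ k)

/-- With N = a + p q, expand 1/N in powers of p q / a and write q^j in binomials. The powers of a go
into `unitSeries`, and (q choose f) is a coefficient of X^f / (1 - X)^(f+1), which makes products
over several factors explicit. -/
theorem small_coprimeSeries {p : ℕ} (hp : p.Prime) (n N : ℕ) :
    Small p n (coeff N (coprimeSeries p) - ∑ j ∈ Finset.range n, (p : ℚ) ^ j *
      lsum ((powerWeights j).map fun y => (((-1) ^ j * (y.1 : ℤ), 1), y.2))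
        fun f => coeff N (unitSeries p (j + 1) * dilate p (binSeries f 1))) := by
  simp only [coeff_unitSeries_mul_dilate hp.pos, coprimeSeries, coeff_mk]
  split_ifs with h
  · have : ∀ l : List (Coef × ℕ), lsum l (fun _ => 0) = 0 := by
      intro l; simp [lsum]
    simpa [this] using Small.zero_right p n
  · have hx : 0 < N % p := Nat.pos_of_ne_zero fun h0 => h (Nat.dvd_of_mod_eq_zero h0)
    have hlt := Nat.mod_lt N hp.pos
    have hN : ((N % p : ℕ) : ℚ) + (p : ℚ) * (N / p : ℕ) = N := by
      exact_mod_cast Nat.mod_add_div N p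
    have e : ∀ j, (p : ℚ) ^ j * lsum ((powerWeights j).map fun y =>
        ((((-1) ^ j * (y.1 : ℤ), 1), y.2) : Coef × ℕ))
          (fun f => (((N % p : ℕ) : ℚ) ^ (j + 1))⁻¹ * coeff (N / p) (binSeries f 1)) =
        (-((p : ℚ) * (N / p : ℕ))) ^ j * (((N % p : ℕ) : ℚ) ^ (j + 1))⁻¹ := by
      intro j
      rw [lsum_mul_left]
      have h1 := sum_powerWeights (N / p) j
      have h2 : lsum ((powerWeights j).map fun y =>
          ((((-1) ^ j * (y.1 : ℤ), 1), y.2) : Coef × ℕ))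
          (fun f => coeff (N / p) (binSeries f 1)) = (-1) ^ j * ((N / p : ℕ) : ℚ) ^ j := by
        rw [← h1, ← List.sum_map_mul_left, lsum, List.map_map]
        congr 1
        refine List.map_congr_left fun y _ => ?_
        have := coeff_binSeries y.2 0 (N / p)
        simp only [zero_add, add_zero] at this
        simp only [Function.comp_apply, cval_int, this]
        push_cast
        ring
      rw [h2, neg_eq_neg_one_mul ((p : ℚ) * _), mul_pow, mul_pow]
      ring
    simp only [e]
    have h3 := inv_sub_geom_sum (x := ((N % p : ℕ) : ℚ)) (z := (p : ℚ) * (N / p : ℕ))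
      (by positivity) (by positivity) n
    rw [hN] at h3
    rw [h3, neg_mul_eq_mul_neg, mul_pow, ← inv_pow]
    exact (((Small.self_pow p n).mul_right ((Small.natCast p _).neg.pow n)).mul_right
      ((Small.inv_lt hp hx hlt).pow n)).mul_right (Small.inv_natCast hp h)

theorem lsum_map {β γ : Type*} (l : List γ) (f : γ → Coef × β) (w : β → ℚ) :
    lsum (l.map f) w = (l.map fun y => cval (f y).1 * w (f y).2).sum := by
  rw [lsum, List.map_map]; rfl

theorem small_peelCoeff {p : ℕ} (hp : p.Prime) (n k : ℕ) (s : ℕ × ℕ × List ℕ) :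
    Small p n (peelCoeff (k + 1) s p -
      ∑ j ∈ Finset.range n, (p : ℚ) ^ j * lsum (peelStep k s j) (peelCoeff k · p)) := by
  obtain ⟨r, F, S⟩ := s
  set Y : ℚ⟦X⟧ := unitProd p S * dilate p (binSeries F S.length) * coprimeSeries p ^ k with hY
  have hYi : IntegralSeries p Y := ((integral_unitProd hp S).mul
    (integral_binSeries p _ _).dilate).mul ((integral_coprimeSeries hp).pow k)
  have h1 : peelCoeff (k + 1) (r, F, S) p = coeff (p * p ^ r) (Y * coprimeSeries p) := by
    rw [peelCoeff, hY, pow_succ, ← mul_assoc]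
  have h2 : ∀ j, lsum (peelStep k (r, F, S) j) (peelCoeff k · p) =
      lsum ((powerWeights j).map fun y => ((((-1) ^ j * (y.1 : ℤ), 1), y.2) : Coef × ℕ))
        fun f => coeff (p * p ^ r) (Y * (unitSeries p (j + 1) * dilate p (binSeries f 1))) := by
    intro j
    rw [peelStep, lsum_map, lsum_map]
    congr 1
    refine List.map_congr_left fun y _ => ?_
    simp only [peelCoeff, unitProd_cons, List.length_cons, ← binSeries_mul, dilate_mul hp.ne_zero,
      hY]
    congr 2
    ring
  rw [h1]
  simp only [h2, coeff_mul (p * p ^ r) Y, lsum_finset_sum, lsum_mul_left, Finset.mul_sum]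
  rw [Finset.sum_comm, ← Finset.sum_sub_distrib]
  refine Small.sum fun x _ => ?_
  have := (hYi x.1).mul_left (small_coprimeSeries hp n x.2)
  rw [mul_sub, Finset.mul_sum] at this
  convert this using 3
  ring

/-- Each variable is at most p - 1. This bounds the range of c independently of p. -/
theorem unitSum_eq_zero (p : ℕ) (S : List ℕ) (N : ℕ) (h : S.length * (p - 1) < N) :
    unitSum p S N = 0 := by
  induction S generalizing N with
  | nil =>
    simp only [List.length_nil, zero_mul] at h
    rw [unitSum, unitProd_nil, coeff_one, if_neg (by omega)]
  | cons s S ih =>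
    rw [unitSum, unitProd_cons, coeff_unitSeries_mul]
    refine Finset.sum_eq_zero fun i _ => ?_
    split_ifs with hi
    · rw [List.length_cons, add_mul] at h
      have := ih (N - i) (by omega)
      rw [unitSum] at this
      rw [this, mul_zero]
    · rw [zero_mul]

theorem coeff_mul_dilate {p : ℕ} (hp : 0 < p) (P : ℕ) (Y g : ℚ⟦X⟧) :
    coeff (p * P) (Y * dilate p g) =
      ∑ c ∈ Finset.range (P + 1), coeff (p * c) Y * coeff (P - c) g := by
  rw [coeff_mul, Finset.Nat.sum_antidiagonal_eq_sum_range_succ_mk]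
  have hinj : Set.InjOn (fun c => p * c) (Finset.range (P + 1) : Set ℕ) := fun a _ b _ h =>
    Nat.eq_of_mul_eq_mul_left hp h
  have h1 : (Finset.range (P + 1)).image (fun c => p * c) ⊆ Finset.range (p * P).succ := by
    intro x
    simp only [Finset.mem_image, Finset.mem_range]
    rintro ⟨c, hc, rfl⟩
    exact Nat.lt_succ_of_le (Nat.mul_le_mul_left p (by omega))
  rw [← Finset.sum_subset h1, Finset.sum_image hinj]
  · refine Finset.sum_congr rfl fun c _ => ?_
    rw [← Nat.mul_sub, dilate, coeff_mk, if_pos (dvd_mul_right p _), Nat.mul_div_cancel_left _ hp]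
  · intro x hx hx'
    rw [dilate, coeff_mk, if_neg, mul_zero]
    intro hd
    have hx := Finset.mem_range.1 hx
    have : p ∣ x := by
      have h2 := (Nat.dvd_sub_iff_right (by omega : x ≤ p * P) (dvd_mul_right p P)).1 hd
      exact h2
    obtain ⟨c, rfl⟩ := this
    refine hx' (Finset.mem_image.2 ⟨c, Finset.mem_range.2 ?_, rfl⟩)
    exact Nat.lt_succ_of_le (Nat.le_of_mul_le_mul_left (Nat.le_of_lt_succ hx) hp)

/-- The residues have total p c, and the dilated series contributes a binomial coefficient at p^r -
c. The list must be nonempty for that binomial formula; this is why at least one factor is peeled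
off first. -/
theorem peelCoeff_zero {p : ℕ} (hp : p.Prime) (r F e : ℕ) (S : List ℕ) :
    peelCoeff 0 (r, F, e :: S) p = peeledVal (r, F, e :: S) p := by
  rw [peelCoeff, pow_zero, mul_one, coeff_mul_dilate hp.pos, peeledVal]
  simp only [List.length_cons, coeff_binSeries]
  set m := S.length with hm
  have h1 : Finset.range (p ^ r + 1) ∩ Finset.range (m + 1) ⊆ Finset.range (p ^ r + 1) :=
    Finset.inter_subset_left
  have h2 : Finset.range (p ^ r + 1) ∩ Finset.range (m + 1) ⊆ Finset.range (m + 1) :=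
    Finset.inter_subset_right
  -- The range of c from the product and the range in `peeledVal` are compared on their
  -- intersection: outside it, either the binomial coefficient or the sum of units is 0.
  rw [← Finset.sum_subset h1, ← Finset.sum_subset h2]
  · refine Finset.sum_congr rfl fun c hc => ?_
    simp only [Finset.mem_inter, Finset.mem_range] at hc
    rw [unitSum]
    congr 3
    omega
  · intro c hc hc'
    simp only [Finset.mem_inter, Finset.mem_range] at hc hc'
    rw [Nat.choose_eq_zero_of_lt (by omega)]; simp
  · intro c hc hc'
    simp only [Finset.mem_inter, Finset.mem_range] at hc hc'
    have h3 := unitSum_eq_zero p (e :: S) (p * c) (by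
      rw [List.length_cons, ← hm]
      have h4 : m + 1 ≤ c := by omega
      calc (m + 1) * (p - 1) < (m + 1) * p := by
            exact Nat.mul_lt_mul_of_pos_left (Nat.sub_lt hp.pos one_pos) (Nat.succ_pos m)
        _ ≤ p * c := by rw [mul_comm]; exact Nat.mul_le_mul_left p h4)
    rw [unitSum] at h3
    rw [h3, zero_mul]

theorem primrec_powerWeights : Primrec powerWeights := by
  refine (Primrec.nat_rec₁ (f := fun _ l => l.flatMap fun y : ℕ × ℕ =>
    [(y.1 * (y.2 + 1), y.2 + 1), (y.1 * y.2, y.2)]) [(1, 0)] ?_).of_eq fun e => ?_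
  · refine Primrec.list_flatMap Primrec.snd ?_
    have a := Primrec.fst.comp (Primrec.snd (α := ℕ × List (ℕ × ℕ)) (β := ℕ × ℕ))
    have b := Primrec.snd.comp (Primrec.snd (α := ℕ × List (ℕ × ℕ)) (β := ℕ × ℕ))
    exact Primrec.list_cons.comp (Primrec.pair (Primrec.nat_mul.comp a (Primrec.succ.comp b))
      (Primrec.succ.comp b)) (Primrec.list_cons.comp (Primrec.pair (Primrec.nat_mul.comp a b) b)
        (Primrec.const []))
  · induction e with
    | zero => rfl
    | succ e ih => rw [powerWeights, ← ih]

/-- The value of a state of the first stage with `k` factors left. -/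
noncomputable def peelVal : ℕ → ℕ × ℕ × List ℕ → ℕ → ℚ
  | 0 => peeledVal
  | k + 1 => peelCoeff (k + 1)

theorem expands_peelCoeff :
    Expands (fun x : ℕ × ℕ × ℕ × List ℕ => peelCoeff (x.1 + 1) x.2) peeledVal := by
  have hg : Primrec fun x : ℕ × ℕ × ℕ × List ℕ => (x.1 + 1, x.2) :=
    Primrec.pair (Primrec.succ.comp Primrec.fst) Primrec.snd
  refine Expands.iterate peelStep ?_ peelVal (fun _ _ => True) (fun _ _ _ _ _ _ => trivial)
    (fun k s _ n _ => ?_) hg (fun _ => trivial)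
  · have hs := Primrec.fst.comp (Primrec.snd (α := ℕ) (β := (ℕ × ℕ × List ℕ) × ℕ))
    have hj := Primrec.snd.comp (Primrec.snd (α := ℕ) (β := (ℕ × ℕ × List ℕ) × ℕ))
    refine Primrec.list_map (primrec_powerWeights.comp hj) ?_
    exact Primrec.pair (Primrec.pair (primrec_int_mul.comp (primrec_int_pow.comp (Primrec.const _)
      (hj.comp Primrec.fst)) (primrec_int_natCast.comp (Primrec.fst.comp Primrec.snd)))
      (Primrec.const 1)) (Primrec.pair (Primrec.fst.comp (hs.comp Primrec.fst)) (Primrec.pair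
        (Primrec.nat_add.comp (Primrec.fst.comp (Primrec.snd.comp (hs.comp Primrec.fst)))
          (Primrec.snd.comp Primrec.snd)) (Primrec.list_cons.comp (hj.comp Primrec.fst)
            (Primrec.snd.comp (Primrec.snd.comp (hs.comp Primrec.fst))))))
  · refine Eventually.of_forall fun p hp => ?_
    have := small_peelCoeff hp n k s
    cases k with
    | zero =>
      have e : ∀ j, lsum (peelStep 0 s j) (peeledVal · p) =
          lsum (peelStep 0 s j) (peelCoeff 0 · p) := fun j => lsum_congr _ fun x hx => by
        obtain ⟨y, _, rfl⟩ := List.mem_map.1 hx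
        exact (peelCoeff_zero hp _ _ _ _).symm
      simp only [← e] at this
      exact this
    | succ k => exact this

/-- `(p ^ r + d)(p ^ r + d - 1) ⋯` (`K` factors) times a sum of units; the data are
`(d, r, c, S)`. -/
noncomputable def fallingVal (K : ℕ) (s : ℕ × ℕ × ℕ × List ℕ) (p : ℕ) : ℚ :=
  ((p ^ s.2.1 + s.1).descFactorial K : ℚ) * unitSum p s.2.2.2 (p * s.2.2.1)

/-- The expansion of one factor of the falling factorial. -/
def fallingStep (K : ℕ) (s : ℕ × ℕ × ℕ × List ℕ) (j : ℕ) :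
    List (Coef × (ℕ × ℕ × ℕ × List ℕ)) :=
  (if j = 0 then [(((s.1 : ℤ) - (K : ℤ), 1), s)] else []) ++
    (if j = s.2.1 then [((1, 1), s)] else [])

theorem fallingVal_succ (K : ℕ) (s : ℕ × ℕ × ℕ × List ℕ) (p : ℕ) :
    fallingVal (K + 1) s p = ((s.1 : ℚ) - K) * fallingVal K s p +
      (p : ℚ) ^ s.2.1 * fallingVal K s p := by
  have h : ((p ^ s.2.1 + s.1).descFactorial (K + 1) : ℚ) =
      ((p : ℚ) ^ s.2.1 + s.1 - K) * ((p ^ s.2.1 + s.1).descFactorial K : ℚ) := by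
    rw [Nat.descFactorial_succ]
    rcases le_or_gt K (p ^ s.2.1 + s.1) with hK | hK
    · rw [Nat.cast_mul, Nat.cast_sub hK]; push_cast; rfl
    · rw [Nat.descFactorial_eq_zero_iff_lt.2 hK]; simp
  rw [fallingVal, h, fallingVal]
  ring

/-- The new factor p^r + (d - K) is already an expansion in powers of p; its term p^r is cut off
when n ≤ r. -/
theorem small_fallingVal {p : ℕ} (hp : p.Prime) {n : ℕ} (hn : 0 < n) (K : ℕ)
    (s : ℕ × ℕ × ℕ × List ℕ) :
    Small p n (fallingVal (K + 1) s p -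
      ∑ j ∈ Finset.range n, (p : ℚ) ^ j * lsum (fallingStep K s j) (fallingVal K · p)) := by
  have hi : Small p 0 (fallingVal K s p) := (Small.natCast p _).mul_left (small_unitSum hp _ _)
  have e : ∑ j ∈ Finset.range n, (p : ℚ) ^ j * lsum (fallingStep K s j) (fallingVal K · p) =
      ((s.1 : ℚ) - K) * fallingVal K s p +
        (if s.2.1 < n then (p : ℚ) ^ s.2.1 * fallingVal K s p else 0) := by
    simp only [fallingStep, lsum_append, mul_add, Finset.sum_add_distrib]
    rw [sum_range_level_zero hn]
    congr 1
    · simp [cval_int]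
    · have : ∀ j, (p : ℚ) ^ j * lsum (if j = s.2.1 then [(((1, 1) : Coef), s)] else [])
          (fallingVal K · p) = if s.2.1 = j then (p : ℚ) ^ s.2.1 * fallingVal K s p else 0 := by
        intro j
        by_cases hj : j = s.2.1
        · simp [hj]
        · simp [hj, Ne.symm hj]
      simp only [this, Finset.sum_ite_eq, Finset.mem_range]
  rw [e, fallingVal_succ]
  split_ifs with h
  · rw [sub_self]; exact Small.zero_right p n
  · rw [add_zero, add_sub_cancel_left]
    exact ((Small.self_pow p s.2.1).mul_right hi).mono (by omega)

theorem expands_fallingVal :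
    Expands (fun x : ℕ × ℕ × ℕ × ℕ × List ℕ => fallingVal x.1 x.2) (fallingVal 0) := by
  refine Expands.iterate fallingStep ?_ fallingVal (fun _ _ => True)
    (fun _ _ _ _ _ _ => trivial) (fun K s _ n hn => Eventually.of_forall fun p hp =>
      small_fallingVal hp hn K s) (g := fun x => x) Primrec.id (fun _ => trivial)
  have hK := Primrec.fst (α := ℕ) (β := (ℕ × ℕ × ℕ × List ℕ) × ℕ)
  have hs := Primrec.fst.comp (Primrec.snd (α := ℕ) (β := (ℕ × ℕ × ℕ × List ℕ) × ℕ))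
  have hj := Primrec.snd.comp (Primrec.snd (α := ℕ) (β := (ℕ × ℕ × ℕ × List ℕ) × ℕ))
  refine Primrec.list_append.comp
    (Primrec.ite (Primrec.eq.comp hj (Primrec.const 0)) (Primrec.list_cons.comp (Primrec.pair
      (Primrec.pair (primrec_int_subNat.comp (Primrec.fst.comp hs) hK) (Primrec.const 1)) hs)
      (Primrec.const [])) (Primrec.const []))
    (Primrec.ite (Primrec.eq.comp hj (Primrec.fst.comp (Primrec.snd.comp hs)))
      (Primrec.list_cons.comp (Primrec.pair (Primrec.const _) hs) (Primrec.const []))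
      (Primrec.const []))

/-- The binomial coefficient is a falling factorial over K!, and K does not depend on p. -/
theorem expands_peeledVal_fallingVal :
    Expands peeledVal fun x : ℕ × ℕ × ℕ × ℕ × List ℕ => fallingVal x.1 x.2 := by
  refine Expands.of_exact (T := fun s => (List.range s.2.2.length).map fun c =>
    ((1, (s.2.1 + s.2.2.length - 1).factorial),
      (s.2.1 + s.2.2.length - 1, (s.2.2.length - 1 - c, s.1, c, s.2.2)))) ?_ fun s => ?_
  · have hr := Primrec.fst.comp (Primrec.fst (α := ℕ × ℕ × List ℕ) (β := ℕ))
    have hF := Primrec.fst.comp (Primrec.snd.comp (Primrec.fst (α := ℕ × ℕ × List ℕ) (β := ℕ)))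
    have hS := Primrec.snd.comp (Primrec.snd.comp (Primrec.fst (α := ℕ × ℕ × List ℕ) (β := ℕ)))
    have hl := Primrec.list_length.comp hS
    have hK := Primrec.pred.comp (Primrec.nat_add.comp hF hl)
    refine Primrec.list_map (Primrec.list_range.comp (Primrec.list_length.comp
      (Primrec.snd.comp Primrec.snd))) ?_
    exact Primrec.pair (Primrec.pair (Primrec.const _) (primrec_factorial.comp hK))
      (Primrec.pair hK (Primrec.pair (Primrec.nat_sub.comp (Primrec.pred.comp hl) Primrec.snd)
        (Primrec.pair hr (Primrec.pair Primrec.snd hS))))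
  · refine Eventually.of_forall fun p _ => ?_
    rw [lsum_map, sum_map_range, peeledVal]
    refine Finset.sum_congr rfl fun c _ => ?_
    simp only [cval, fallingVal, Nat.descFactorial_eq_factorial_mul_choose]
    have := Nat.cast_ne_zero (R := ℚ).2 (s.2.1 + s.2.2.length - 1).factorial_ne_zero
    push_cast
    field_simp

theorem expands_fallingVal_zero : Expands (fallingVal 0) stateVal := by
  refine Expands.of_exact (T := fun s => [((1, 1), ([], (s.2.2.1, s.2.2.2), none))]) ?_ fun s => ?_
  · exact Primrec.list_cons.comp (Primrec.pair (Primrec.const _) (Primrec.pair (Primrec.const _)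
      (Primrec.pair (Primrec.snd.comp Primrec.snd) (Primrec.const none)))) (Primrec.const [])
  · refine Eventually.of_forall fun p hp => ?_
    have h : chain [] delta p = 1 := by
      rw [← harmonicVal_eq_chain [] hp.pos]; rfl
    simp [fallingVal, stateVal, h]

theorem expands_curiousSum :
    Expands (fun (a : ℕ × ℕ) p => curiousSum (a.1 + 1) (a.2 + 1) p) harmonicVal := by
  have h : Expands (fun (a : ℕ × ℕ) p => curiousSum (a.1 + 1) (a.2 + 1) p)
      fun x : ℕ × ℕ × ℕ × List ℕ => peelCoeff (x.1 + 1) x.2 := by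
    -- The exponents are shifted by 1 on both sides: p^(r+1) = p * p^r is the multiple of p at which
    -- coefficients are taken, and k + 1 factors remain to be expanded.
    refine Expands.of_exact (T := fun a => [((1, 1), (a.2, (a.1, 0, [])))]) ?_ fun a => ?_
    · exact Primrec.list_cons.comp (Primrec.pair (Primrec.const _) (Primrec.pair Primrec.snd
        (Primrec.pair Primrec.fst (Primrec.const _)))) (Primrec.const [])
    · refine Eventually.of_forall fun p hp => ?_
      have h1 : dilate p (binSeries 0 0) = 1 := by
        rw [dilate_eq_expand hp.ne_zero]; simp [binSeries]
      simp [peelCoeff, curiousSum_eq_coeff hp, h1, pow_succ']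
  exact h.trans (expands_peelCoeff.trans (expands_peeledVal_fallingVal.trans
    (expands_fallingVal.trans (expands_fallingVal_zero.trans expands_stateVal))))

end MHS

theorem mainTheorem3 :
    (∃ E : ℕ × ℕ × ℕ → List MHS.TermData, Computable E ∧
      ∀ r k n : ℕ, 0 < r → 0 < k → 0 < n →
        (∀ t ∈ E (r, k, n), t.Valid) ∧
        ∃ p₀ : ℕ, ∀ p : ℕ, p₀ ≤ p → p.Prime →
          MHS.RatModEq (p ^ n) (MHS.curiousSum r k p)
            ((E (r, k, n)).map fun t => t.value p).sum) ∧
    (∀ r k : ℕ, 0 < r → 0 < k → MHS.QInfty.curious r k ∈ MHS.mhsAlgebra) :=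
  MHS.main_of_expands MHS.expands_curiousSum
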